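/- **Setting.** Let $k\ge 1$, let $Q$ be a smooth (Hausdorff) $n$-manifold and let $(E,[\cdot,\cdot]_E,\rho)$ be a Lie algebroid of rank $m$ over $Q$, with projection $\tau:E\to Q$. Put $M=\mathbb R^k\times\oplus^kE$, where $\oplus^kE$ is the Whitney sum of $k$ copies of $E$; a point of $M$ is $x=(t,b_q)$ with $b_q=(b_1,\dots,b_k)\in E_q^k$, and $\pi:M\to Q$, $\pi(t,b_q)=q$. The $k$-prolongation $\mathcal T^E_k(\oplus^kE)\to M$ is the vector bundle with fibre at $x$ $$\{(a,W): a=(a_1,\dots,a_k)\in E_q^k,\ W=(v_1,\dots,v_k)\in (T_xM)^k,\ \rho(a_A)=T\pi(v_A)\ \text{for all }A\}.$$ For an element $z=(a,W)$ over $x$ put $\overline{\mathcal Y}{}_B^C(z)=dt^C(v_B)$ and, for $f\in C^\infty(M)$, $d^Af(z)=v_A(f)$. The bracket of (local) projectable sections $Z=(\sigma\circ\pi,X)$, $Z'=(\sigma'\circ\pi,X')$ (with $\sigma_A,\sigma'_A$ sections of $E$ and $X_A,X'_A$ vector fields on $M$) is $[Z,Z']=(([\sigma_A,\sigma'_A]_E)_A,([X_A,X'_A])_A)$,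 and for a $1$-section $\mu$ of the dual bundle $d^A\mu(Z,Z')=X_A(\mu(Z'))-X'_A(\mu(Z))-\mu([Z,Z'])$. For $a\in E_q^k$ let $(a)^{V_A}_x\in T_xM$ be the velocity at $s=0$ of $s\mapsto(t,b_1,\dots,b_A+s\,a_A,\dots,b_k)$, and let $\widetilde S^A(a,W)=(0,(0,\dots,(a)^{V_A}_x,\dots,0))$ and $\Delta_A(x)=(0,(0,\dots,(b_q)^{V_A}_x,\dots,0))$ (non-zero vector in the $A$-th slot). Let $L:M\to\mathbb R$ be smooth and regular, i.e. the matrix $\big(\partial^2L/\partial y^\alpha_A\partial y^\beta_B\big)$ is invertible at every point, where $y^\alpha_A$ are the fibre coordinates of $\oplus^kE$ induced by a basis $e_\alpha$ of the fibre of $E$. Put $E_L=\sum_A (b_q)^{V_A}(L)-L$, $\Theta_L^A=d^AL\circ\widetilde S^A$, and $\Omega_L^A=-d^A\Theta_L^A$ (a tensorial $2$-section, determined by its values on projectable sections). A section $\xi$ of $\mathcal T^E_k(\oplus^kE)$ is a SOPDE if $\widetilde S^A(\xi)=\Delta_A$ and $\overline{\mathcal Y}{}_A^B(\xi)=\delta_A^B$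 for all $A,B$. Write $\xi=(a,(\xi_1,\dots,\xi_k))$ with $\xi_A$ vector fields on $M$; a smooth map $\eta:\mathbb R^k\to M$ is an integral section of $\xi$ if $\eta_*(t)(\partial/\partial t^A)=\xi_A(\eta(t))$ for all $t,A$. **Theorem.** Let $\xi$ be a smooth section of $\mathcal T^E_k(\oplus^kE)$ with $\overline{\mathcal Y}{}_B^C(\xi)=\delta_B^C$ for all $B,C$, that satisfies at least one of (a) $\displaystyle \imath_\xi\Omega_L^A=\frac1k\Big(d^AE_L+\sum_{C=1}^k\frac{\partial L}{\partial t^C}\,\overline{\mathcal Y}{}_A^C\Big)$ for all $A=1,\dots,k$; (b) (the sum of these equations on diagonal elements, a consequence of (a)) $\displaystyle \sum_{A=1}^k\Omega_L^A\big(\xi,(z,\dots,z)\big)=dE_L(v)+\sum_{C=1}^k\frac{\partial L}{\partial t^C}\,dt^C(v)$ for every $x\in M$ and every $z=(a,v)\in E_{\pi(x)}\times T_xM$ with $\rho(a)=T\pi(v)$, where $(z,\dots,z)$ stands for the element $((a,\dots,a),(v,\dots,v))$. 1. Then $\xi$ is a SOPDE. 2. Let $\Phi=(\overline\Phi,\underline\Phi)$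 be a Lie algebroid morphism from $T\mathbb R^k\to\mathbb R^k$ to $E\to Q$ (a smooth vector bundle map with $d\,\Phi^*\mu=\Phi^*d^E\mu$ for all $l\ge 0$ and all $\mu\in\mathrm{Sec}(\bigwedge^lE^*)$), and let $\widetilde\Phi(t)=\big(t,\overline\Phi(\partial/\partial t^1|_t),\dots,\overline\Phi(\partial/\partial t^k|_t)\big)$. If $\widetilde\Phi$ is an integral section of $\xi$, then it is a solution of the Euler–Lagrange field equations on $E$: in the coordinates $(t^A,q^i,y^\alpha_A)$ induced by any chart $(q^i)$ of $Q$ and any local basis $(e_\alpha)$ of sections of $E$, with $\rho(e_\alpha)=\rho^i_\alpha\,\partial/\partial q^i$ and $[e_\alpha,e_\beta]_E=\mathcal C^\gamma_{\alpha\beta}e_\gamma$, the components $\widetilde\Phi(t)=(\phi^B(t),\phi^i(t),\phi^\alpha_A(t))$ are smooth and satisfy $$\frac{\partial\phi^B}{\partial t^A}=\delta^B_A,\qquad \frac{\partial\phi^i}{\partial t^A}=\rho^i_\alpha\,\phi^\alpha_A,\qquad 0=\frac{\partial\phi^\alpha_A}{\partial t^B}-\frac{\partial\phi^\alpha_B}{\partial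 t^A}+\mathcal C^\alpha_{\beta\gamma}\,\phi^\beta_B\,\phi^\gamma_A,$$ $$\sum_{A=1}^k\frac{\partial}{\partial t^A}\Big(\frac{\partial L}{\partial y^\alpha_A}\circ\widetilde\Phi\Big)=\rho^i_\alpha\,\frac{\partial L}{\partial q^i}\circ\widetilde\Phi-\sum_{A=1}^k\phi^\beta_A\,\mathcal C^\gamma_{\alpha\beta}\,\frac{\partial L}{\partial y^\gamma_A}\circ\widetilde\Phi$$ (summation over repeated indices $i,\alpha,\beta,\gamma$; structure functions evaluated along $\underline\Phi$). -/

import Mathlib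

open Bundle Set Function Topology
open scoped Manifold ContDiff Topology Bundle

noncomputable section

section WhitneySum

variable {Q : Type*} {F : Type*} [NormedAddCommGroup F] [NormedSpace ℝ F]

/-- The Whitney sum `⊕ᵏE` of `k` copies of a vector bundle `E` (its fibres). -/
abbrev WhitneySum (k : ℕ) (E : Q → Type*) : Q → Type _ := fun q => Fin k → E q

variable (k : ℕ) (E : Q → Type*) [TopologicalSpace Q]
  [∀ q, AddCommGroup (E q)] [∀ q, Module ℝ (E q)] [TopologicalSpace (TotalSpace F E)]
  [∀ q, TopologicalSpace (E q)] [FiberBundle F E]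

namespace WhitneySum

variable {E}

/-- The local trivialization of `⊕ᵏE` induced by one of `E`. -/
def pretrivialization (e : Trivialization F (π F E)) [e.IsLinear ℝ] :
    Pretrivialization (Fin k → F) (π (Fin k → F) (WhitneySum k E)) where
  toFun p := ⟨p.1, fun A => e.continuousLinearMapAt ℝ p.1 (p.2 A)⟩
  invFun p := ⟨p.1, fun A => e.symmL ℝ p.1 (p.2 A)⟩
  source := TotalSpace.proj ⁻¹' e.baseSet
  target := e.baseSet ×ˢ Set.univ
  map_source' := fun ⟨_, _⟩ h => ⟨h, Set.mem_univ _⟩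
  map_target' := fun ⟨_, _⟩ h => h.1
  left_inv' := fun ⟨q, a⟩ h => by
    simp only [TotalSpace.mk_inj]
    funext A
    exact e.symmL_continuousLinearMapAt h (a A)
  right_inv' := fun ⟨q, a⟩ h => by
    simp only [Prod.mk_right_inj]
    funext A
    exact e.continuousLinearMapAt_symmL h.1 (a A)
  open_target := e.open_baseSet.prod isOpen_univ
  baseSet := e.baseSet
  open_baseSet := e.open_baseSet
  source_eq := rfl
  target_eq := rfl
  proj_toFun _ _ := rfl

instance pretrivialization_isLinear (e : Trivialization F (π F E)) [e.IsLinear ℝ] :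
    (pretrivialization k e).IsLinear ℝ where
  linear q _ :=
    { map_add a b := by
        funext A
        exact map_add (e.continuousLinearMapAt ℝ q) (a A) (b A)
      map_smul c a := by
        funext A
        exact map_smul (e.continuousLinearMapAt ℝ q) c (a A) }

variable (F) in
/-- The componentwise action of an endomorphism of `F` on `Fin k → F`. -/
def diagonal : (F →L[ℝ] F) →L[ℝ] ((Fin k → F) →L[ℝ] (Fin k → F)) :=
  ∑ A : Fin k, (ContinuousLinearMap.compL ℝ (Fin k → F) F (Fin k → F)
      (ContinuousLinearMap.single ℝ (fun _ => F) A)).comp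
    ((ContinuousLinearMap.compL ℝ (Fin k → F) F F).flip
      (ContinuousLinearMap.proj (R := ℝ) (φ := fun _ : Fin k => F) A))

theorem diagonal_apply (g : F →L[ℝ] F) (v : Fin k → F) (A : Fin k) :
    diagonal F k g v A = g (v A) := by
  simp [diagonal, Finset.sum_apply, Pi.single_apply]

theorem diagonal_coordChange (e e' : Trivialization F (π F E)) [e.IsLinear ℝ] [e'.IsLinear ℝ]
    (q : Q) (hq : q ∈ e.baseSet ∩ e'.baseSet) (v : Fin k → F) :
    diagonal F k (e.coordChangeL ℝ e' q : F →L[ℝ] F) v =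
      (pretrivialization k e' ⟨q, (pretrivialization k e).symm q v⟩).2 := by
  have h1 : (pretrivialization k e).symm q v = fun A => e.symmL ℝ q (v A) := by
    rw [Pretrivialization.symm_apply _ hq.1]
    rfl
  funext A
  rw [diagonal_apply, h1]
  change _ = e'.continuousLinearMapAt ℝ q (e.symmL ℝ q (v A))
  rw [ContinuousLinearEquiv.coe_coe, Trivialization.coordChangeL_apply _ _ hq,
    e'.continuousLinearMapAt_apply (R := ℝ), e'.coe_linearMapAt_of_mem hq.2, e.symmL_apply hq.1]

variable (F E) [VectorBundle ℝ F E]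

/-- The vector bundle structure of `⊕ᵏE`. -/
def vectorPrebundle : VectorPrebundle ℝ (Fin k → F) (WhitneySum k E) where
  pretrivializationAtlas :=
    {e | ∃ (e₀ : Trivialization F (π F E)) (_ : MemTrivializationAtlas e₀),
      e = pretrivialization k e₀}
  pretrivialization_linear' := by
    rintro _ ⟨e, he, rfl⟩
    infer_instance
  pretrivializationAt q := pretrivialization k (trivializationAt F E q)
  mem_base_pretrivializationAt q := mem_baseSet_trivializationAt F E q
  pretrivialization_mem_atlas q := ⟨trivializationAt F E q, inferInstance, rfl⟩
  exists_coordChange := by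
    rintro _ ⟨e, he, rfl⟩ _ ⟨e', he', rfl⟩
    exact ⟨fun q => diagonal F k (e.coordChangeL ℝ e' q : F →L[ℝ] F),
      (diagonal F k).continuous.comp_continuousOn (continuousOn_coordChange ℝ e e'),
      diagonal_coordChange k e e'⟩
  totalSpaceMk_isInducing := by
    intro q
    let l : E q ≃L[ℝ] F := (trivializationAt F E q).continuousLinearEquivAt ℝ q
      (mem_baseSet_trivializationAt F E q)
    have : IsInducing fun a : Fin k → E q => (q, fun A => l (a A)) :=
      isInducing_const_prod.mpr (Homeomorph.piCongrRight fun _ => l.toHomeomorph).isInducing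
    convert! this using 1
    funext a
    refine Prod.ext rfl (funext fun A => ?_)
    change (trivializationAt F E q).continuousLinearMapAt ℝ q (a A) = l (a A)
    rw [← Trivialization.coe_continuousLinearEquivAt_eq _ (mem_baseSet_trivializationAt F E q)]

instance topologicalSpaceTotalSpace : TopologicalSpace (TotalSpace (Fin k → F) (WhitneySum k E)) :=
  (vectorPrebundle F k E).totalSpaceTopology

instance fiberBundle : FiberBundle (Fin k → F) (WhitneySum k E) :=
  (vectorPrebundle F k E).toFiberBundle

instance vectorBundle : VectorBundle ℝ (Fin k → F) (WhitneySum k E) :=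
  (vectorPrebundle F k E).toVectorBundle

variable {n : ℕ} [ChartedSpace (EuclideanSpace ℝ (Fin n)) Q]
  [ContMDiffVectorBundle ∞ F E (𝓡 n)]

instance vectorPrebundle_isContMDiff :
    (vectorPrebundle F k E).IsContMDiff (𝓡 n) ∞ where
  exists_contMDiffCoordChange := by
    rintro _ ⟨e, he, rfl⟩ _ ⟨e', he', rfl⟩
    exact ⟨fun q => diagonal F k (e.coordChangeL ℝ e' q : F →L[ℝ] F),
      (diagonal F k).contMDiff.comp_contMDiffOn (contMDiffOn_coordChangeL e e'),
      diagonal_coordChange k e e'⟩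

instance contMDiffVectorBundle :
    ContMDiffVectorBundle ∞ (Fin k → F) (WhitneySum k E) (𝓡 n) :=
  (vectorPrebundle F k E).contMDiffVectorBundle (𝓡 n)

end WhitneySum
end WhitneySum

section LieAlgebroid

/-- The model space `ℝⁿ`. -/
abbrev Eucl (n : ℕ) : Type := EuclideanSpace ℝ (Fin n)

/-- Global smooth sections of a vector bundle `E` of rank `m` over an `n`-manifold `Q`. -/
abbrev Sec (n m : ℕ) {Q : Type*} [TopologicalSpace Q] [ChartedSpace (Eucl n) Q]
    (E : Q → Type*) [TopologicalSpace (TotalSpace (Eucl m) E)]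
    [∀ q, TopologicalSpace (E q)] [FiberBundle (Eucl m) E] : Type _ :=
  Cₛ^∞⟮𝓡 n; Eucl m, E⟯

/-- A Lie algebroid structure on a vector bundle `E → Q` of rank `m` over an `n`-manifold. -/
structure LieAlgebroid (n m : ℕ) {Q : Type*} [TopologicalSpace Q] [ChartedSpace (Eucl n) Q]
    [IsManifold (𝓡 n) ∞ Q] (E : Q → Type*) [∀ q, AddCommGroup (E q)] [∀ q, Module ℝ (E q)]
    [TopologicalSpace (TotalSpace (Eucl m) E)] [∀ q, TopologicalSpace (E q)]
    [FiberBundle (Eucl m) E] [VectorBundle ℝ (Eucl m) E] where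
  bracket : Sec n m E →ₗ[ℝ] Sec n m E →ₗ[ℝ] Sec n m E
  bracket_self : ∀ σ, bracket σ σ = 0
  jacobi : ∀ σ₁ σ₂ σ₃, bracket σ₁ (bracket σ₂ σ₃) =
    bracket (bracket σ₁ σ₂) σ₃ + bracket σ₂ (bracket σ₁ σ₃)
  anchor : ∀ q, E q →ₗ[ℝ] TangentSpace (𝓡 n) q
  contMDiff_anchor : ContMDiff ((𝓡 n).prod 𝓘(ℝ, Eucl m)) (𝓡 n).tangent ∞
    (fun p : TotalSpace (Eucl m) E => (⟨p.proj, anchor p.proj p.snd⟩ : TangentBundle (𝓡 n) Q))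
  leibniz : ∀ (f : Q → ℝ), ContMDiff (𝓡 n) 𝓘(ℝ, ℝ) ∞ f → ∀ σ₁ σ₂ τ : Sec n m E,
    (∀ q, τ q = f q • σ₂ q) → ∀ q, bracket σ₁ τ q =
      f q • bracket σ₁ σ₂ q + mvfderiv (𝓡 n) f q (anchor q (σ₁ q)) • σ₂ q

/-- The tangent bundle as a Lie algebroid: commutator of vector fields, identity anchor. -/
def LieAlgebroid.tangent (n : ℕ) (Q : Type*) [TopologicalSpace Q] [ChartedSpace (Eucl n) Q]
    [IsManifold (𝓡 n) ∞ Q] : LieAlgebroid n n (TangentSpace (𝓡 n) : Q → Type) where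
  bracket := haveI : IsManifold (𝓡 n) (minSmoothness ℝ 2) Q :=
      (by rw [minSmoothness_of_isRCLikeNormedField]; infer_instance)
    LinearMap.mk₂ ℝ
    (fun X Y => ⟨VectorField.mlieBracket (𝓡 n) X Y, by
      intro q
      have : IsManifold (𝓡 n) (((⊤ : ℕ∞) : WithTop ℕ∞) + 1) Q := by
        simpa using (inferInstance : IsManifold (𝓡 n) ∞ Q)
      exact ContMDiffAt.mlieBracket_vectorField (m := ⊤) (n := ⊤) (X.contMDiff q) (Y.contMDiff q)
        (by simp [minSmoothness_of_isRCLikeNormedField])⟩)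
    (fun X₁ X₂ Y => by
      ext1 q
      exact VectorField.mlieBracket_add_left X₁.mdifferentiableAt X₂.mdifferentiableAt)
    (fun c X Y => by
      ext1 q
      exact VectorField.mlieBracket_const_smul_left X.mdifferentiableAt)
    (fun X Y₁ Y₂ => by
      ext1 q
      exact VectorField.mlieBracket_add_right Y₁.mdifferentiableAt Y₂.mdifferentiableAt)
    (fun c X Y => by
      ext1 q
      exact VectorField.mlieBracket_const_smul_right Y.mdifferentiableAt)
  bracket_self X := by
    ext1 q
    exact congrFun VectorField.mlieBracket_self q
  jacobi X Y Z := by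
    ext1 q
    have : IsManifold (𝓡 n) (minSmoothness ℝ 3) Q := by
      rw [minSmoothness_of_isRCLikeNormedField]
      infer_instance
    have h2 : minSmoothness ℝ 2 ≤ (∞ : WithTop ℕ∞) := by
      rw [minSmoothness_of_isRCLikeNormedField]
      exact ENat.LEInfty.out
    exact VectorField.leibniz_identity_mlieBracket_apply ((X.contMDiff q).of_le h2)
      ((Y.contMDiff q).of_le h2) ((Z.contMDiff q).of_le h2)
  anchor q := LinearMap.id
  contMDiff_anchor := contMDiff_id
  leibniz f hf X Y Z hZ q := by
    have h : (Z : ∀ q, TangentSpace (𝓡 n) q) = f • (Y : ∀ q, TangentSpace (𝓡 n) q) := funext hZ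
    change VectorField.mlieBracket (𝓡 n) X Z q = _
    rw [h, VectorField.mlieBracket_smul_right (hf.mdifferentiableAt (by simp)) Y.mdifferentiableAt,
      add_comm]
    rfl

namespace LieAlgebroid

variable {n m : ℕ} {Q : Type*} [TopologicalSpace Q] [ChartedSpace (Eucl n) Q]
  [IsManifold (𝓡 n) ∞ Q] {E : Q → Type*} [∀ q, AddCommGroup (E q)] [∀ q, Module ℝ (E q)]
  [TopologicalSpace (TotalSpace (Eucl m) E)] [∀ q, TopologicalSpace (E q)]
  [FiberBundle (Eucl m) E] [VectorBundle ℝ (Eucl m) E]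

/-- The bracket part of the exterior differential of an `l`-form (absent for `l = 0`). The pairs
`i < j` in `{0, …, l + 1}` are written with `i : Fin (l + 1)` and `j : Fin (l + 2)`; then
`j.succAbove ∘ i.succAbove` enumerates the indices different from `i` and `j`. -/
def dBracket (D : LieAlgebroid n m E) : ∀ {l : ℕ}, (∀ q, (E q) [⋀^Fin l]→ₗ[ℝ] ℝ) →
    (Fin (l + 1) → Sec n m E) → Q → ℝ
  | 0, _, _, _ => 0
  | l + 1, μ, σ, q => ∑ i : Fin (l + 1), ∑ j : Fin (l + 2), if i.castSucc < j then
      (-1 : ℝ) ^ ((i : ℕ) + (j : ℕ)) * μ q (Fin.cons (D.bracket (σ i.castSucc) (σ j) q)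
        (fun r : Fin l => σ (j.succAbove (i.succAbove r)) q))
    else 0

/-- The exterior differential `(d^E μ)(σ₀, …, σ_l)` of an `l`-form `μ`. -/
def d (D : LieAlgebroid n m E) {l : ℕ} (μ : ∀ q, (E q) [⋀^Fin l]→ₗ[ℝ] ℝ)
    (σ : Fin (l + 1) → Sec n m E) (q : Q) : ℝ :=
  (∑ i : Fin (l + 1), (-1 : ℝ) ^ (i : ℕ) *
    mvfderiv (𝓡 n) (fun q' => μ q' (fun r => σ (i.succAbove r) q')) q (D.anchor q (σ i q))) +
  D.dBracket μ σ q

/-- Smoothness of an `l`-form: smooth on smooth sections. -/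
def IsSmoothForm {l : ℕ} (μ : ∀ q, (E q) [⋀^Fin l]→ₗ[ℝ] ℝ) : Prop :=
  ∀ σ : Fin l → Sec n m E, ContMDiff (𝓡 n) 𝓘(ℝ, ℝ) ∞ (fun q => μ q (fun i => σ i q))

/-- Morphisms of Lie algebroids: smooth vector bundle maps with `d (Φ^* μ) = Φ^* (d μ)` for all
forms `μ`. As differentials are tensorial, `Φ^* (d μ)` is evaluated at `q` on the sections `σ i`
through arbitrary sections `σ' i` of the target with the value `Φ (σ i q)` at `Φ q`. -/
structure Hom {n' m' : ℕ} {Q' : Type*} [TopologicalSpace Q'] [ChartedSpace (Eucl n') Q']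
    [IsManifold (𝓡 n') ∞ Q'] {E' : Q' → Type*} [∀ q, AddCommGroup (E' q)] [∀ q, Module ℝ (E' q)]
    [TopologicalSpace (TotalSpace (Eucl m') E')] [∀ q, TopologicalSpace (E' q)]
    [FiberBundle (Eucl m') E'] [VectorBundle ℝ (Eucl m') E']
    (D : LieAlgebroid n m E) (D' : LieAlgebroid n' m' E') where
  base : Q → Q'
  map : ∀ q, E q →ₗ[ℝ] E' (base q)
  contMDiff_map : ContMDiff ((𝓡 n).prod 𝓘(ℝ, Eucl m)) ((𝓡 n').prod 𝓘(ℝ, Eucl m')) ∞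
    (fun p : TotalSpace (Eucl m) E =>
      (⟨base p.proj, map p.proj p.snd⟩ : TotalSpace (Eucl m') E'))
  map_d : ∀ (l : ℕ) (μ : ∀ q, (E' q) [⋀^Fin l]→ₗ[ℝ] ℝ),
    IsSmoothForm (n := n') (m := m') μ →
    ∀ (q : Q) (σ : Fin (l + 1) → Sec n m E) (σ' : Fin (l + 1) → Sec n' m' E'),
      (∀ i, σ' i (base q) = map q (σ i q)) →
      D.d (fun q' => (μ (base q')).compLinearMap (map q')) σ q = D'.d μ σ' (base q)

end LieAlgebroid
end LieAlgebroid

section KCosymplectic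

/-- The manifold `ℝᵏ × ⊕ᵏE`; a point is `x = (t, ⟨q, b⟩)` with `b A ∈ E q` for `A : Fin k`, so that
`x.1 = t`, `x.2.proj = q` and `x.2.snd = b`. -/
abbrev Phase (m k : ℕ) {Q : Type*} (E : Q → Type*) : Type _ :=
  Eucl k × TotalSpace (Fin k → Eucl m) (WhitneySum k E)

/-- The model with corners of `ℝᵏ × ⊕ᵏE`. -/
abbrev phaseModel (n m k : ℕ) :
    ModelWithCorners ℝ (Eucl k × (Eucl n × (Fin k → Eucl m)))
      (ModelProd (Eucl k) (ModelProd (Eucl n) (Fin k → Eucl m))) :=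
  (𝓡 k).prod ((𝓡 n).prod 𝓘(ℝ, Fin k → Eucl m))

variable {n m k : ℕ} {Q : Type*} [TopologicalSpace Q] [ChartedSpace (Eucl n) Q]
  {E : Q → Type*} [∀ q, AddCommGroup (E q)] [∀ q, Module ℝ (E q)]
  [TopologicalSpace (TotalSpace (Eucl m) E)] [∀ q, TopologicalSpace (E q)]
  [FiberBundle (Eucl m) E] [VectorBundle ℝ (Eucl m) E]

/-- The vector space of pairs `(a, W)`, where `a = (a_1, …, a_k) ∈ (E_q)ᵏ` and
`W = (v_1, …, v_k) ∈ (T_x(ℝᵏ × ⊕ᵏE))ᵏ`, over a point `x = (t, b_q)` of `ℝᵏ × ⊕ᵏE`. -/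
abbrev KPair (n : ℕ) {m k : ℕ} {Q : Type*} [TopologicalSpace Q] [ChartedSpace (Eucl n) Q]
    {E : Q → Type*} [∀ q, AddCommGroup (E q)] [∀ q, Module ℝ (E q)]
    [TopologicalSpace (TotalSpace (Eucl m) E)] [∀ q, TopologicalSpace (E q)]
    [FiberBundle (Eucl m) E] [VectorBundle ℝ (Eucl m) E] (x : Phase m k E) : Type _ :=
  (Fin k → E x.2.proj) × (Fin k → TangentSpace (phaseModel n m k) x)

/-- The tangent map `Tπ : T_x(ℝᵏ × ⊕ᵏE) → T_q Q` of the projection `π (t, b_q) = q`. -/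
def tangentProj (x : Phase m k E) :
    TangentSpace (phaseModel n m k) x →L[ℝ] TangentSpace (𝓡 n) x.2.proj :=
  mfderiv (phaseModel n m k) (𝓡 n) (fun y : Phase m k E => y.2.proj) x

/-- `dt^C (v) = v(t^C)` for a tangent vector `v` of `ℝᵏ × ⊕ᵏE`. -/
def dt (C : Fin k) (x : Phase m k E) (v : TangentSpace (phaseModel n m k) x) : ℝ :=
  mvfderiv (phaseModel n m k) (fun y : Phase m k E => y.1 C) x v

/-- `d^A f (a, W) = v_A(f)`, for a function `f` on `ℝᵏ × ⊕ᵏE`. -/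
def dFun (A : Fin k) (f : Phase m k E → ℝ) (x : Phase m k E) (z : KPair n x) : ℝ :=
  mvfderiv (phaseModel n m k) f x (z.2 A)

/-- The forms `Ȳ_B^C` dual to the sections `𝒴^B_C`: `Ȳ_B^C (a, W) = dt^C(v_B)`. -/
def yBar (B C : Fin k) (x : Phase m k E) (z : KPair n x) : ℝ :=
  dt C x (z.2 B)

/-- The tangent vector `(a_q)^{V_A}` at `x = (t, b_q)`: the velocity at `s = 0` of the curve
`s ↦ (t, b_1, …, b_A + s a_A, …, b_k)`. -/
def verticalVector (A : Fin k) (x : Phase m k E) (a : Fin k → E x.2.proj) :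
    TangentSpace (phaseModel n m k) x :=
  mfderiv 𝓘(ℝ, ℝ) (phaseModel n m k) (fun s : ℝ =>
    ((x.1, ⟨x.2.proj, Function.update x.2.snd A (x.2.snd A + s • a A)⟩) : Phase m k E)) 0 (1 : ℝ)

/-- The vertical `A`-lift `ξ^{V_A}(t, a_q, b_q)`, for `x = (t, b_q)`: the pair `(0, W)` where `W` has
the vector `(a_q)^{V_A}` in the slot `A` and zero in the other slots. -/
def verticalLift (A : Fin k) (x : Phase m k E) (a : Fin k → E x.2.proj) : KPair n x :=
  (0, Pi.single A (verticalVector A x a))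

theorem contMDiff_verticalCurve (A : Fin k) (x : Phase m k E) (a : Fin k → E x.2.proj) :
   ContMDiff 𝓘(ℝ, ℝ) (phaseModel n m k) ∞ (fun s : ℝ =>
    ((x.1, ⟨x.2.proj, Function.update x.2.snd A (x.2.snd A + s • a A)⟩) : Phase m k E)) := by
  intro s
  refine ContMDiffAt.prodMk contMDiffAt_const ?_
  rw [Bundle.contMDiffAt_totalSpace]
  refine ⟨contMDiffAt_const, ?_⟩
  dsimp only
  apply ContDiffAt.contMDiffAt
  have : ∀ s : ℝ, (trivializationAt (Fin k → Eucl m) (WhitneySum k E) x.2.proj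
      (⟨x.2.proj, Function.update x.2.snd A (x.2.snd A + s • a A)⟩ :
        TotalSpace (Fin k → Eucl m) (WhitneySum k E))).2 =
      fun B => (trivializationAt (Eucl m) E x.2.proj).continuousLinearMapAt ℝ x.2.proj (x.2.snd B) +
        if B = A then s • (trivializationAt (Eucl m) E x.2.proj).continuousLinearMapAt ℝ x.2.proj (a A) else 0 := by
    intro s
    funext B
    change (trivializationAt (Eucl m) E x.2.proj).continuousLinearMapAt ℝ x.2.proj (Function.update x.2.snd A (x.2.snd A + s • a A) B) = _
    by_cases h : B = A
    · subst h; simp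
    · simp [h]
  simp_rw [this]
  rw [contDiffAt_pi]
  intro B
  by_cases h : B = A
  · simp only [h, if_true]; fun_prop
  · simp only [h, if_false]; fun_prop

theorem tangentProj_verticalVector (A : Fin k) (x : Phase m k E) (a : Fin k → E x.2.proj) :
   tangentProj (n := n) x (verticalVector A x a) = 0 := by
  rw [verticalVector]
  let g : ℝ → Phase m k E := fun s : ℝ =>
    ((x.1, ⟨x.2.proj, Function.update x.2.snd A (x.2.snd A + s • a A)⟩) : Phase m k E)
  have hg0 : g 0 = x := by
    simp [g]
  have hg : MDifferentiableAt 𝓘(ℝ, ℝ) (phaseModel n m k) g 0 := 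
    (contMDiff_verticalCurve A x a).mdifferentiableAt (by simp)
  have hp : MDifferentiableAt (phaseModel n m k) (𝓡 n) (fun y : Phase m k E => y.2.proj) (g 0) := by
    have h : ContMDiff (phaseModel n m k) (𝓡 n) ∞ (fun y : Phase m k E => y.2.proj) :=
      (Bundle.contMDiff_proj _).comp contMDiff_snd
    exact h.mdifferentiableAt (by simp)
  have := mfderiv_comp (0:ℝ) hp hg
  have h0 : ((fun y : Phase m k E => y.2.proj) ∘ g) = fun _ => x.2.proj := rfl
  rw [h0, mfderiv_const] at this
  have h3 := congrArg (fun l => l (1:ℝ)) this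
  rw [hg0] at h3
  exact h3.symm

/-- The vertical endomorphism `S̃^A (a, W) = ξ^{V_A}(t, a, b)`. -/
def verticalEndo (A : Fin k) (x : Phase m k E) (z : KPair n x) : KPair n x :=
  verticalLift A x z.1

/-- The Liouville section `Δ_A (t, b) = ξ^{V_A}(t, b, b)`. -/
def liouville (A : Fin k) (x : Phase m k E) : KPair n x :=
  verticalLift A x x.2.snd

/-- The energy `E_L = ∑_A τ̃₂^A(Δ_A) L - L`. -/
def energy (n : ℕ) {m k : ℕ} {Q : Type*} [TopologicalSpace Q] [ChartedSpace (Eucl n) Q]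
    {E : Q → Type*} [∀ q, AddCommGroup (E q)] [∀ q, Module ℝ (E q)]
    [TopologicalSpace (TotalSpace (Eucl m) E)] [∀ q, TopologicalSpace (E q)]
    [FiberBundle (Eucl m) E] [VectorBundle ℝ (Eucl m) E] (L : Phase m k E → ℝ)
    (x : Phase m k E) : ℝ :=
  ∑ A : Fin k, dFun (n := n) A L x (liouville A x) - L x

/-- The Poincaré–Cartan `1`-section `Θ_L^A = d^A L ∘ S̃^A`. -/
def thetaL (L : Phase m k E → ℝ) (A : Fin k) (x : Phase m k E) (z : KPair n x) : ℝ :=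
  dFun A L x (verticalEndo A x z)

/-- The partial derivative `∂L/∂t^C`. -/
def dLdt (L : Phase m k E → ℝ) (C : Fin k) (x : Phase m k E) : ℝ :=
  fderiv ℝ (fun t : Eucl k => L (t, x.2)) x.1 (EuclideanSpace.single C 1)

/-- `L` is regular: the matrix `(∂²L / ∂y^α_A ∂y^β_B)` is invertible at every point, where
`y^α_A` are the coordinates on the fibres of `⊕ᵏE` induced by a basis of the fibres of `E`. -/
def IsRegularLagrangian (L : Phase m k E → ℝ) : Prop :=
  ∀ (x : Phase m k E) (e : Module.Basis (Fin m) ℝ (E x.2.proj)),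
    IsUnit (Matrix.det (Matrix.of fun i j : Fin k × Fin m =>
      fderiv ℝ (fun y : Fin k → Fin m → ℝ =>
          fderiv ℝ (fun y' : Fin k → Fin m → ℝ =>
            L (x.1, ⟨x.2.proj, fun A => ∑ α, y' A α • e α⟩)) y (Pi.single i.1 (Pi.single i.2 1)))
        (fun A α => e.repr (x.2.snd A) α) (Pi.single j.1 (Pi.single j.2 1))))

variable [IsManifold (𝓡 n) ∞ Q]

namespace LieAlgebroid

/-- The fibre at `x = (t, b_q)` of the `k`-prolongation `𝒯^E_k(⊕ᵏE)`: the pairs `(a, W)` with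
`ρ(a_A) = Tπ(v_A)` for all `A`. -/
def prolongation (D : LieAlgebroid n m E) (x : Phase m k E) : Submodule ℝ (KPair n x) where
  carrier := {z | ∀ A, D.anchor x.2.proj (z.1 A) = tangentProj x (z.2 A)}
  add_mem' {z w} hz hw A := by
    simp only [Set.mem_ofPred_eq] at hz hw
    simp [hz A, hw A]
  zero_mem' A := by simp
  smul_mem' c z hz A := by
    simp only [Set.mem_ofPred_eq] at hz
    simp [hz A]

/-- Vertical lifts, hence `S̃^A (a, W)` and `Δ_A`, lie in the `k`-prolongation. -/
theorem verticalLift_mem_prolongation (D : LieAlgebroid n m E) (A : Fin k) (x : Phase m k E)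
    (a : Fin k → E x.2.proj) : verticalLift A x a ∈ D.prolongation x := by
  intro B
  by_cases h : B = A
  · subst h
    simp [verticalLift, tangentProj_verticalVector]
  · simp [verticalLift, h]

end LieAlgebroid

variable [ContMDiffVectorBundle ∞ (Eucl m) E (𝓡 n)]

instance phase_isManifold : IsManifold (phaseModel n m k) ∞ (Phase m k E) := inferInstance

/-- Smooth sections of `𝒯^E_k(⊕ᵏE) → ℝᵏ × ⊕ᵏE`. -/
structure ProlongationSection (k : ℕ) (D : LieAlgebroid n m E) where
  toFun : ∀ x : Phase m k E, KPair n x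
  mem : ∀ x, toFun x ∈ D.prolongation x
  contMDiff_fst : ∀ A, ContMDiff (phaseModel n m k) ((𝓡 n).prod 𝓘(ℝ, Eucl m)) ∞
    (fun x : Phase m k E => (⟨x.2.proj, (toFun x).1 A⟩ : TotalSpace (Eucl m) E))
  contMDiff_snd : ∀ A, ContMDiff (phaseModel n m k) (phaseModel n m k).tangent ∞
    (fun x : Phase m k E => (⟨x, (toFun x).2 A⟩ : TangentBundle (phaseModel n m k) (Phase m k E)))

/-- Projectable sections `(σ_A ∘ π, X_A)` of `𝒯^E_k(⊕ᵏE)` over a set `U`: here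
`σ = (σ_1, …, σ_k)` is a section of `⊕ᵏE` and `X = (X_1, …, X_k)` a `k`-vector field, smooth on `U`
and with `ρ ∘ σ_A ∘ π = Tπ ∘ X_A` on `U`. (Used for open `U` only.) -/
structure ProjectableSection (D : LieAlgebroid n m E) (U : Set (Phase m k E)) where
  σ : Fin k → Sec n m E
  X : Fin k → ∀ x : Phase m k E, TangentSpace (phaseModel n m k) x
  contMDiffOn_X : ∀ A, ContMDiffOn (phaseModel n m k) (phaseModel n m k).tangent ∞
    (fun x : Phase m k E => (⟨x, X A x⟩ : TangentBundle (phaseModel n m k) (Phase m k E))) U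
  related : ∀ A, ∀ x ∈ U, D.anchor x.2.proj (σ A x.2.proj) = tangentProj x (X A x)

namespace ProjectableSection

variable {D : LieAlgebroid n m E} {U : Set (Phase m k E)}

/-- The value of a projectable section at a point. -/
def eval (Z : ProjectableSection D U) (x : Phase m k E) : KPair n x :=
  (fun A => Z.σ A x.2.proj, fun A => Z.X A x)

/-- The bracket `[Z, Z']^π = ([σ_A, σ'_A]_E, [X_A, X'_A])` of projectable sections. -/
def bracket (Z Z' : ProjectableSection D U) (x : Phase m k E) : KPair n x :=
  (fun A => D.bracket (Z.σ A) (Z'.σ A) x.2.proj,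
    fun A => VectorField.mlieBracket (phaseModel n m k) (Z.X A) (Z'.X A) x)

end ProjectableSection

/-- `d^A μ (Z, Z') = τ̃₂^A(Z) (μ(Z')) - τ̃₂^A(Z') (μ(Z)) - μ([Z, Z']^π)` for a `1`-section `μ`. -/
def dOne {D : LieAlgebroid n m E} {U : Set (Phase m k E)} (A : Fin k)
    (μ : ∀ x : Phase m k E, KPair n x → ℝ) (Z Z' : ProjectableSection D U) (x : Phase m k E) : ℝ :=
  dFun A (fun y => μ y (Z'.eval y)) x (Z.eval x) - dFun A (fun y => μ y (Z.eval y)) x (Z'.eval x) -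
    μ x (Z.bracket Z' x)

/-- The Poincaré–Cartan `2`-section `Ω_L^A = - d^A Θ_L^A`, on projectable sections. -/
def omegaL {D : LieAlgebroid n m E} {U : Set (Phase m k E)} (L : Phase m k E → ℝ) (A : Fin k)
    (Z Z' : ProjectableSection D U) (x : Phase m k E) : ℝ :=
  - dOne A (thetaL L A) Z Z' x

namespace ProlongationSection

variable {D : LieAlgebroid n m E}

/-- The geometric field equations
`Ȳ_B^C(ξ) = δ_B^C`, `ι_ξ Ω_L^A = (1/k) (d^A E_L + ∑_C (∂L/∂t^C) Ȳ_A^C)` for all `A`.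
`Ω_L^A` is a tensor, determined by its values on (local) projectable sections, which pass through
every element of the prolongation; so `(ι_ξ Ω_L^A)(z')` at `x` is `Ω_L^A(Z, Z')(x)` for projectable
sections `Z`, `Z'` through `ξ(x)` and `z'`. -/
def FieldEquations (L : Phase m k E → ℝ) (ξ : ProlongationSection k D) : Prop :=
  (∀ x, ∀ B C : Fin k, yBar B C x (ξ.toFun x) = if B = C then 1 else 0) ∧
  ∀ (A : Fin k) (U : Set (Phase m k E)), IsOpen U → ∀ (Z Z' : ProjectableSection D U), ∀ x ∈ U,
    Z.eval x = ξ.toFun x →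
      omegaL L A Z Z' x = (1 / (k : ℝ)) *
        (dFun A (energy n L) x (Z'.eval x) + ∑ C, dLdt L C x * yBar A C x (Z'.eval x))

/-- The summed field equations
`Ȳ_B^C(ξ) = δ_B^C`, `∑_A Ω_L^A(ξ, (z, …, z)) = dE_L(v) + ∑_C (∂L/∂t^C) dt^C(v)`, for all
`z = (a, v)` with `ρ(a) = Tπ(v)`, where `(z, …, z)` is the element `((a, …, a), (v, …, v))` of the
`k`-prolongation. -/
def SummedFieldEquations (L : Phase m k E → ℝ) (ξ : ProlongationSection k D) : Prop :=
  (∀ x, ∀ B C : Fin k, yBar B C x (ξ.toFun x) = if B = C then 1 else 0) ∧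
  ∀ (U : Set (Phase m k E)), IsOpen U → ∀ (Z Z' : ProjectableSection D U), ∀ x ∈ U,
    Z.eval x = ξ.toFun x →
    ∀ (a : E x.2.proj) (v : TangentSpace (phaseModel n m k) x),
      Z'.eval x = (fun _ => a, fun _ => v) →
      ∑ A, omegaL L A Z Z' x =
        mvfderiv (phaseModel n m k) (energy n L) x v + ∑ C, dLdt L C x * dt C x v

/-- `ξ` is a second order partial differential equation: `S̃^A(ξ) = Δ_A`, `Ȳ_A^B(ξ) = δ_A^B`. -/
def IsSOPDE (ξ : ProlongationSection k D) : Prop :=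
  (∀ A x, verticalEndo A x (ξ.toFun x) = liouville A x) ∧
  ∀ x, ∀ A B : Fin k, yBar A B x (ξ.toFun x) = if A = B then 1 else 0

/-- `η` is an integral section of `ξ`: `τ̃₂^A(ξ)(η(t)) = η_*(t)(∂/∂t^A)`. -/
def IsIntegralSection (ξ : ProlongationSection k D) (η : Eucl k → Phase m k E) : Prop :=
  ContMDiff (𝓡 k) (phaseModel n m k) ∞ η ∧
  ∀ (t : Eucl k) (A : Fin k), (ξ.toFun (η t)).2 A =
    mfderiv (𝓡 k) (phaseModel n m k) η t (EuclideanSpace.single A (1 : ℝ) : Eucl k)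

end ProlongationSection

/-- The map `Φ̃ : ℝᵏ → ℝᵏ × ⊕ᵏE`, `t ↦ (t, Φ(∂/∂t^1|_t), …, Φ(∂/∂t^k|_t))`, associated to a Lie
algebroid morphism `Φ : Tℝᵏ → E`. -/
def LieAlgebroid.Hom.associatedMap {D : LieAlgebroid n m E}
    (Φ : LieAlgebroid.Hom (LieAlgebroid.tangent k (Eucl k)) D) (t : Eucl k) : Phase m k E :=
  (t, ⟨Φ.base t, fun A => Φ.map t (EuclideanSpace.single A (1 : ℝ) : Eucl k)⟩)

/-- The partial derivative `∂f/∂x^i` of a function on `ℝᵖ`. -/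
def pd {p : ℕ} (i : Fin p) (f : Eucl p → ℝ) (x : Eucl p) : ℝ :=
  fderiv ℝ f x (EuclideanSpace.single i 1)

/-- The function `L` in the coordinates `(t^A, q^i, y^α_A)` given by a chart `c` of `Q` and a frame
`e` of `E`. -/
def localL (c : OpenPartialHomeomorph Q (Eucl n)) (e : Fin m → Sec n m E) (L : Phase m k E → ℝ)
    (t : Eucl k) (q : Eucl n) (y : Fin k → Fin m → ℝ) : ℝ :=
  L (t, ⟨c.symm q, fun A => ∑ α, y A α • e α (c.symm q)⟩)

/-- `∂L/∂q^i` in the coordinates `(t^A, q^i, y^α_A)`. -/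
def dLdq (c : OpenPartialHomeomorph Q (Eucl n)) (e : Fin m → Sec n m E) (L : Phase m k E → ℝ)
    (i : Fin n) (t : Eucl k) (q : Eucl n) (y : Fin k → Fin m → ℝ) : ℝ :=
  pd i (fun q' => localL c e L t q' y) q

/-- `∂L/∂y^α_A` in the coordinates `(t^A, q^i, y^α_A)`. -/
def dLdy (c : OpenPartialHomeomorph Q (Eucl n)) (e : Fin m → Sec n m E) (L : Phase m k E → ℝ)
    (A : Fin k) (α : Fin m) (t : Eucl k) (q : Eucl n) (y : Fin k → Fin m → ℝ) : ℝ :=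
  fderiv ℝ (fun y' => localL c e L t q y') y (Pi.single A (Pi.single α 1))

/-- The structure functions `ρ^i_α` of a Lie algebroid: `ρ(e_α) = ρ^i_α ∂/∂q^i`. -/
def structRho (D : LieAlgebroid n m E) (c : OpenPartialHomeomorph Q (Eucl n))
    (e : Fin m → Sec n m E) (i : Fin n) (α : Fin m) (q : Q) : ℝ :=
  mvfderiv (𝓡 n) (fun q' => c q' i) q (D.anchor q (e α q))

/-- The structure functions `C^γ_{αβ}` of a Lie algebroid: `[e_α, e_β] = C^γ_{αβ} e_γ`. -/
def structC (D : LieAlgebroid n m E) {e : Fin m → Sec n m E} {U : Set Q}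
    (he : IsLocalFrameOn (𝓡 n) (Eucl m) ∞ (fun α q => e α q) U) (γ α β : Fin m) (q : Q) : ℝ :=
  he.coeff γ q (D.bracket (e α) (e β) q)

/-- `ψ(t) = (φ^B(t), φ^i(t), φ^α_A(t))` is a solution of the Euler–Lagrange field equations written
in terms of the Lie algebroid: in the coordinates given by any chart `c = (q^i)` of `Q` and any local
basis `e_α` of sections of `E` over an open set `U`,
`∂φ^B/∂t^A = δ_A^B`, `∂φ^i/∂t^A = φ^α_A ρ^i_α`,
`0 = ∂φ^α_A/∂t^B - ∂φ^α_B/∂t^A + C^α_{βγ} φ^β_B φ^γ_A`,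
`∑_A ∂/∂t^A (∂L/∂y^α_A ∘ ψ) = ρ^i_α ∂L/∂q^i - y^β_A C^γ_{αβ} ∂L/∂y^γ_A` along `ψ`.
(The local basis is made of restrictions of global sections; every local basis is of this form near
a given point.) -/
def IsEulerLagrangeSolution (D : LieAlgebroid n m E) (L : Phase m k E → ℝ)
    (ψ : Eucl k → Phase m k E) : Prop :=
  ContMDiff (𝓡 k) (phaseModel n m k) ∞ ψ ∧
  ∀ c ∈ IsManifold.maximalAtlas (𝓡 n) ∞ Q, ∀ (U : Set Q), IsOpen U → U ⊆ c.source →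
  ∀ (e : Fin m → Sec n m E) (he : IsLocalFrameOn (𝓡 n) (Eucl m) ∞ (fun α q => e α q) U),
    let φt : Fin k → Eucl k → ℝ := fun B s => (ψ s).1 B
    let φq : Fin n → Eucl k → ℝ := fun i s => c (ψ s).2.proj i
    let φy : Fin k → Fin m → Eucl k → ℝ := fun A α s => he.coeff α (ψ s).2.proj ((ψ s).2.snd A)
    ∀ t : Eucl k, (ψ t).2.proj ∈ U →
      (∀ A B, pd A (φt B) t = if A = B then 1 else 0) ∧
      (∀ A i, pd A (φq i) t = ∑ α, φy A α t * structRho D c e i α (ψ t).2.proj) ∧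
      (∀ A B α, 0 = pd B (φy A α) t - pd A (φy B α) t +
        ∑ β, ∑ γ, structC D he α β γ (ψ t).2.proj * φy B β t * φy A γ t) ∧
      (∀ α, ∑ A, pd A (fun s =>
          dLdy c e L A α (ψ s).1 (c (ψ s).2.proj) (fun A' α' => φy A' α' s)) t =
        ∑ i, structRho D c e i α (ψ t).2.proj *
            dLdq c e L i (ψ t).1 (c (ψ t).2.proj) (fun A' α' => φy A' α' t) -
          ∑ A, ∑ β, ∑ γ, φy A β t * structC D he γ α β (ψ t).2.proj *
            dLdy c e L A γ (ψ t).1 (c (ψ t).2.proj) (fun A' α' => φy A' α' t))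

end KCosymplectic

end

/-! Everything is local. A chart of `Q` and a frame of `E` turn `M` into an open piece of the vector
space of triples w = (t, q, y) and `L` into a function ℓ = `coordL`. On projectable sections whose
frame components f, f' are constant, Θ_L^A is Dℓ(w) applied to the vertical vector f_A in slot A.
Hence, with u, u' the coordinate vectors of `Z`, `Z'`, Ω_L^A(Z, Z') = D²ℓ(u'_A, f_A) − D²ℓ(u_A,
f'_A) + Dℓ([f_A, f'_A]), where each last argument is placed in slot A (`omegaL_eq_coord`). The right
side of the summed equation is D²ℓ(v, (0,0,y)) − Dℓ(0, v_q, 0) (`mvfderiv_energy_eq_coord`).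
Condition (a) implies (b), so only the summed equation is studied (`SummedFieldEquations.coord`).

Two kinds of test elements suffice. A vertical one, (0, (0,0,h)), kills anchor and bracket and
leaves D²ℓ((0,0,h), (0,0,a − y)) = 0, where a is the algebroid component of ξ. Regularity then gives
a = y, the SOPDE property (`fst_eq`). The element (e_α, (0, ρ(e_α), 0)) then has its two D²ℓ terms
in the direction ρ(e_α) cancel. What remains relates the derivative of ∂L/∂y^α_A along ξ_A to
ρ(e_α)L and a bracket term, which is the Euler–Lagrange equation along an integral section
(`eulerLagrange`).

The equation for ∂φ^i/∂t^A is the compatibility ρ(a_A) = Tπ(ξ_A) combined with a = y. The equation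
with structure functions does not involve `L`: it is dΦ^* = Φ^*d on the dual coframe
(`maurerCartan`). -/

noncomputable section

/-! ### Coordinates on ℝᵏ × ⊕ᵏE from a chart and a frame. -/

section FrameCoordinates

variable {n m k : ℕ} {Q : Type*} [TopologicalSpace Q] [ChartedSpace (Eucl n) Q]
  {E : Q → Type*} [∀ q, AddCommGroup (E q)] [∀ q, Module ℝ (E q)]
  [TopologicalSpace (TotalSpace (Eucl m) E)] [∀ q, TopologicalSpace (E q)]
  [FiberBundle (Eucl m) E] [VectorBundle ℝ (Eucl m) E]

/-- The space of coordinates `(t^A, q^i, y^α_A)`. -/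
abbrev PhaseCoord (n m k : ℕ) : Type := Eucl k × (Eucl n × (Fin k → Fin m → ℝ))

namespace Phase

theorem contMDiff_proj : ContMDiff (phaseModel n m k) (𝓡 n) ∞ (fun x : Phase m k E => x.2.proj) :=
  (Bundle.contMDiff_proj _).comp contMDiff_snd

theorem trivializationAt_whitneySum_apply (q₀ : Q) (p : TotalSpace (Fin k → Eucl m) (WhitneySum k E))
    (hp : p.proj ∈ (trivializationAt (Eucl m) E q₀).baseSet) (A : Fin k) :
    (trivializationAt (Fin k → Eucl m) (WhitneySum k E) q₀ p).2 A =
      (trivializationAt (Eucl m) E q₀ ⟨p.proj, p.snd A⟩).2 := by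
  change (trivializationAt (Eucl m) E q₀).continuousLinearMapAt ℝ p.proj (p.2 A) = _
  rw [(trivializationAt (Eucl m) E q₀).continuousLinearMapAt_apply (R := ℝ),
    (trivializationAt (Eucl m) E q₀).coe_linearMapAt_of_mem hp]

theorem contMDiff_component (A : Fin k) :
    ContMDiff (phaseModel n m k) ((𝓡 n).prod 𝓘(ℝ, Eucl m)) ∞
      (fun x : Phase m k E => (⟨x.2.proj, x.2.snd A⟩ : TotalSpace (Eucl m) E)) := by
  intro x
  rw [Bundle.contMDiffAt_totalSpace]
  refine ⟨contMDiff_proj x, ?_⟩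
  have h : ContMDiffAt (phaseModel n m k) ((𝓡 n).prod 𝓘(ℝ, Fin k → Eucl m)) ∞
      (fun x : Phase m k E => x.2) x := contMDiffAt_snd
  rw [Bundle.contMDiffAt_totalSpace] at h
  refine (contMDiffAt_pi_space.1 h.2 A).congr_of_eventuallyEq ?_
  have hs : (fun x : Phase m k E => x.2.proj) ⁻¹' (trivializationAt (Eucl m) E x.2.proj).baseSet ∈
      𝓝 x := (contMDiff_proj (n := n)).continuous.continuousAt.preimage_mem_nhds
    ((trivializationAt (Eucl m) E x.2.proj).open_baseSet.mem_nhds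
      (FiberBundle.mem_baseSet_trivializationAt' _))
  filter_upwards [hs] with y hy
  exact (trivializationAt_whitneySum_apply _ _ hy A).symm

end Phase

section Coeff

omit [VectorBundle ℝ (Eucl m) E] in
theorem IsLocalFrameOn.coeff_sum {e : Fin m → ∀ q, E q} {U : Set Q}
    (he : IsLocalFrameOn (𝓡 n) (Eucl m) ∞ e U) {q : Q} (hq : q ∈ U) (y : Fin m → ℝ) (α : Fin m) :
    he.coeff α q (∑ β, y β • e β q) = y α := by
  have h : ∑ β, y β • e β q = ∑ β, y β • he.toBasisAt hq β := by simp
  rw [h, IsLocalFrameOn.coeff, dif_pos hq, Module.Basis.coord_apply, Module.Basis.repr_sum_self]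

variable {H' N V' : Type*} [NormedAddCommGroup V'] [NormedSpace ℝ V'] [TopologicalSpace H']
  {I' : ModelWithCorners ℝ V' H'} [TopologicalSpace N] [ChartedSpace H' N]

/-- The coefficient vector in a frame of a smooth map to the total space is smooth. -/
theorem IsLocalFrameOn.contMDiffAt_coeff [ContMDiffVectorBundle ∞ (Eucl m) E (𝓡 n)]
    {e : Fin m → ∀ q, E q} {U : Set Q} (hU : IsOpen U)
    (he : IsLocalFrameOn (𝓡 n) (Eucl m) ∞ e U) {g : N → TotalSpace (Eucl m) E} {x : N}
    (hg : ContMDiffAt I' ((𝓡 n).prod 𝓘(ℝ, Eucl m)) ∞ g x) (hx : (g x).proj ∈ U) :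
    ContMDiffAt I' 𝓘(ℝ, Fin m → ℝ) ∞ (fun y α => he.coeff α (g y).proj (g y).snd) x := by
  set T := trivializationAt (Eucl m) E (g x).proj
  have hb : (g x).proj ∈ T.baseSet := FiberBundle.mem_baseSet_trivializationAt' _
  rw [Bundle.contMDiffAt_totalSpace] at hg
  -- `B q` is the matrix of the frame in the trivialization. It is smooth and invertible near the
  -- point, and the coefficients are its inverse applied to the trivialized vector, so smoothness of
  -- operator inversion finishes the proof.
  let B : Q → ((Fin m → ℝ) →L[ℝ] Eucl m) := fun q =>
    ∑ α, (ContinuousLinearMap.proj (R := ℝ) (φ := fun _ : Fin m => ℝ) α).smulRight (T ⟨q, e α q⟩).2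
  have hB : ContMDiffAt (𝓡 n) 𝓘(ℝ, (Fin m → ℝ) →L[ℝ] Eucl m) ∞ B (g x).proj := by
    refine ContMDiffAt.sum fun α _ => ?_
    have h1 := he.contMDiffAt hU hx α
    rw [Bundle.contMDiffAt_section] at h1
    exact (ContinuousLinearMap.smulRightL ℝ (Fin m → ℝ) (Eucl m)
      (ContinuousLinearMap.proj α)).contMDiff.contMDiffAt.comp _ h1
  have hequiv : ∀ q ∈ U ∩ T.baseSet, ∃ l : (Fin m → ℝ) ≃L[ℝ] Eucl m,
      (l : (Fin m → ℝ) →L[ℝ] Eucl m) = B q ∧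
        ∀ v : E q, l (fun α => he.coeff α q v) = (T ⟨q, v⟩).2 := by
    intro q hq
    let l := ((he.toBasisAt hq.1).equivFun.symm.trans (T.linearEquivAt ℝ q hq.2))
    refine ⟨l.toContinuousLinearEquiv, ?_, fun v => ?_⟩
    · ext1 y
      simp [l, B, Module.Basis.equivFun_symm_apply, map_sum]
    · have h2 : (fun α => he.coeff α q v) = (he.toBasisAt hq.1).equivFun v := by
        funext α
        simp [IsLocalFrameOn.coeff, hq.1]
      simp only [l, h2, LinearEquiv.coe_toContinuousLinearEquiv', LinearEquiv.trans_apply,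
        LinearEquiv.symm_apply_apply]
      rfl
  have hUb : ∀ᶠ y in 𝓝 x, (g y).proj ∈ U ∩ T.baseSet :=
    hg.1.continuousAt.preimage_mem_nhds ((hU.inter T.open_baseSet).mem_nhds ⟨hx, hb⟩)
  obtain ⟨l, hl, -⟩ := hequiv _ ⟨hx, hb⟩
  have hinv : ContMDiffAt I' 𝓘(ℝ, Eucl m →L[ℝ] (Fin m → ℝ)) ∞
      (fun y => (B (g y).proj).inverse) x := by
    have h3 := contDiffAt_map_inverse (𝕜 := ℝ) (n := ∞) l
    rw [hl] at h3
    exact h3.contMDiffAt.comp x (hB.comp x hg.1)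
  refine (hinv.clm_apply hg.2).congr_of_eventuallyEq ?_
  filter_upwards [hUb] with y hy
  obtain ⟨l, hl, hv⟩ := hequiv _ hy
  rw [← hl, ContinuousLinearMap.inverse_equiv, ContinuousLinearEquiv.coe_coe,
    ContinuousLinearEquiv.eq_symm_apply, hv]

end Coeff

variable (c : OpenPartialHomeomorph Q (Eucl n)) {e : Fin m → Sec n m E} {U : Set Q}
  (he : IsLocalFrameOn (𝓡 n) (Eucl m) ∞ (fun α q => e α q) U)

/-- The coordinates `(t^A, q^i, y^α_A)` induced by a chart and a frame. -/
def coordMap (x : Phase m k E) : PhaseCoord n m k :=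
  (x.1, c x.2.proj, fun A α => he.coeff α x.2.proj (x.2.snd A))

variable (e) in
/-- The point with given coordinates. -/
def coordInv (w : PhaseCoord n m k) : Phase m k E :=
  (w.1, ⟨c.symm w.2.1, fun A => ∑ α, w.2.2 A α • e α (c.symm w.2.1)⟩)

variable {c}

omit [VectorBundle ℝ (Eucl m) E] in
theorem coordInv_coordMap (hUc : U ⊆ c.source) {x : Phase m k E} (hx : x.2.proj ∈ U) :
    coordInv c e (coordMap c he x) = x := by
  obtain ⟨t, q, b⟩ := x
  dsimp only at hx
  -- `c.symm (c q)` equals `q` only propositionally, so the two fibres are different types;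
  -- generalizing the base point lets the equality be eliminated.
  have h : ∀ q', q' = q → (⟨q', fun A => ∑ α, he.coeff α q (b A) • e α q'⟩ :
      TotalSpace (Fin k → Eucl m) (WhitneySum k E)) = ⟨q, b⟩ := by
    rintro _ rfl
    rw [TotalSpace.mk_inj]
    funext A
    have := (he.toBasisAt hx).sum_repr (b A)
    simpa [IsLocalFrameOn.coeff, hx] using this
  exact Prod.ext rfl (h _ (c.left_inv (hUc hx)))

omit [VectorBundle ℝ (Eucl m) E] in
theorem coordMap_coordInv {w : PhaseCoord n m k} (hw : w.2.1 ∈ c.target)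
    (hwU : c.symm w.2.1 ∈ U) : coordMap c he (coordInv c e w) = w := by
  refine Prod.ext rfl (Prod.ext (c.right_inv hw) ?_)
  funext A α
  exact he.coeff_sum hwU _ α

variable [ContMDiffVectorBundle ∞ (Eucl m) E (𝓡 n)]

theorem contMDiffAt_coordMap (hc : c ∈ IsManifold.maximalAtlas (𝓡 n) ∞ Q) (hU : IsOpen U)
    (hUc : U ⊆ c.source) {x : Phase m k E} (hx : x.2.proj ∈ U) :
    ContMDiffAt (phaseModel n m k) 𝓘(ℝ, PhaseCoord n m k) ∞ (coordMap c he) x := by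
  refine contMDiffAt_fst.prodMk_space (ContMDiffAt.prodMk_space ?_ ?_)
  · exact (contMDiffAt_of_mem_maximalAtlas hc (hUc hx)).comp x (Phase.contMDiff_proj x)
  · rw [contMDiffAt_pi_space]
    intro A
    exact IsLocalFrameOn.contMDiffAt_coeff hU he (Phase.contMDiff_component A x) hx

omit [ContMDiffVectorBundle ∞ (Eucl m) E (𝓡 n)] in
-- Combinations of global sections are smooth whether or not those sections form a frame, so this
-- holds over the whole chart target.
theorem contMDiffAt_coordInv (hc : c ∈ IsManifold.maximalAtlas (𝓡 n) ∞ Q)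
    {w : PhaseCoord n m k} (hw : w.2.1 ∈ c.target) :
    ContMDiffAt 𝓘(ℝ, PhaseCoord n m k) (phaseModel n m k) ∞ (coordInv c e) w := by
  have hq : ContMDiffAt 𝓘(ℝ, PhaseCoord n m k) (𝓡 n) ∞
      (fun w : PhaseCoord n m k => c.symm w.2.1) w :=
    ContMDiffAt.comp (g := c.symm) w (contMDiffAt_symm_of_mem_maximalAtlas hc hw)
      (contDiff_fst.comp contDiff_snd).contMDiff.contMDiffAt
  refine ContMDiffAt.prodMk contDiff_fst.contMDiff.contMDiffAt ?_
  rw [Bundle.contMDiffAt_totalSpace]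
  refine ⟨hq, ?_⟩
  set T := trivializationAt (Eucl m) E (c.symm w.2.1)
  have hmem : ∀ᶠ v : PhaseCoord n m k in 𝓝 w, c.symm v.2.1 ∈ T.baseSet :=
    hq.continuousAt.preimage_mem_nhds (T.open_baseSet.mem_nhds
      (FiberBundle.mem_baseSet_trivializationAt' _))
  have h : ContMDiffAt 𝓘(ℝ, PhaseCoord n m k) 𝓘(ℝ, Fin k → Eucl m) ∞
      (fun v : PhaseCoord n m k => fun A =>
        ∑ α, v.2.2 A α • (T ⟨c.symm v.2.1, e α (c.symm v.2.1)⟩).2) w := by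
    rw [contMDiffAt_pi_space]
    intro A
    refine ContMDiffAt.sum fun α _ => ?_
    have h1 := (e α).contMDiff (c.symm w.2.1)
    rw [Bundle.contMDiffAt_section] at h1
    have h2 : ContMDiffAt 𝓘(ℝ, PhaseCoord n m k) 𝓘(ℝ, ℝ) ∞
        (fun v : PhaseCoord n m k => v.2.2 A α) w :=
      (ContDiff.contMDiff (by fun_prop)).contMDiffAt
    have h3 := h2.smul (h1.comp w hq)
    exact h3
  refine h.congr_of_eventuallyEq ?_
  filter_upwards [hmem] with v hv
  funext A
  refine (Phase.trivializationAt_whitneySum_apply _ (coordInv c e v).2 hv A).trans ?_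
  have h4 : ∀ a : E (c.symm v.2.1), (T ⟨c.symm v.2.1, a⟩).2 = T.linearMapAt ℝ _ a := fun a => by
    rw [T.coe_linearMapAt_of_mem hv]
  change (T ⟨c.symm v.2.1, ∑ α, v.2.2 A α • e α (c.symm v.2.1)⟩).2 = _
  simp only [h4, map_sum, map_smul]

end FrameCoordinates

/-! ### Calculus of vector-valued derivatives on manifolds. -/

section VectorValuedDerivative

variable {V H M : Type*} [NormedAddCommGroup V] [NormedSpace ℝ V] [TopologicalSpace H]
  {I : ModelWithCorners ℝ V H} [TopologicalSpace M] [ChartedSpace H M]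
  {V' H' M' : Type*} [NormedAddCommGroup V'] [NormedSpace ℝ V'] [TopologicalSpace H']
  {I' : ModelWithCorners ℝ V' H'} [TopologicalSpace M'] [ChartedSpace H' M']
  {F G : Type*} [NormedAddCommGroup F] [NormedSpace ℝ F] [NormedAddCommGroup G] [NormedSpace ℝ G]

theorem Filter.EventuallyEq.mvfderiv_eq {f g : M → F} {x : M} (h : f =ᶠ[𝓝 x] g) :
    mvfderiv I f x = mvfderiv I g x := by
  ext v
  exact congrArg (fun l : TangentSpace I x →L[ℝ] F => l v) h.mfderiv_eq

theorem mvfderiv_comp_mfderiv {f : M → M'} {g : M' → F} {x : M}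
    (hg : MDifferentiableAt I' 𝓘(ℝ, F) g (f x)) (hf : MDifferentiableAt I I' f x)
    (v : TangentSpace I x) :
    mvfderiv I (fun y => g (f y)) x v = mvfderiv I' g (f x) (mfderiv I I' f x v) :=
  mfderiv_comp_apply x hg hf v

theorem mvfderiv_eq_fderiv {f : F → G} {x : F} (v : F) :
    mvfderiv 𝓘(ℝ, F) f x v = fderiv ℝ f x v := by
  simp only [mvfderiv, mfderiv_eq_fderiv]
  rfl

theorem fderiv_comp_mvfderiv {f : M → F} {g : F → G} {x : M}
    (hg : DifferentiableAt ℝ g (f x)) (hf : MDifferentiableAt I 𝓘(ℝ, F) f x)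
    (v : TangentSpace I x) :
    mvfderiv I (fun y => g (f y)) x v = fderiv ℝ g (f x) (mvfderiv I f x v) := by
  rw [mvfderiv_comp_mfderiv hg.mdifferentiableAt hf]
  exact mvfderiv_eq_fderiv _

/-- The derivative of a smooth function along a smooth vector field is smooth. -/
theorem ContMDiffOn.mvfderiv_apply [IsManifold I ∞ M] {f : M → F} {s : Set M} (hs : IsOpen s)
    (hf : ContMDiffOn I 𝓘(ℝ, F) ∞ f s) {X : ∀ x, TangentSpace I x}
    (hX : ContMDiffOn I I.tangent ∞ (fun x => (⟨x, X x⟩ : TangentBundle I M)) s) :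
    ContMDiffOn I 𝓘(ℝ, F) ∞ (fun x => mvfderiv I f x (X x)) s := by
  have : IsManifold I 1 M := IsManifold.of_le (n := ∞) (by simp)
  -- The derivative along `X` is the vector component of the tangent map of `f` composed with `X`.
  have h1 := (hf.contMDiffOn_tangentMapWithin (m := ∞) (by simp) hs.uniqueMDiffOn).comp hX
    (fun x hx => hx)
  intro x hx
  have h2 := (contMDiff_snd_tangentBundle_modelSpace F 𝓘(ℝ, F)).contMDiffAt.comp x
    ((h1 x hx).contMDiffAt (hs.mem_nhds hx))
  refine (h2.congr_of_eventuallyEq ?_).contMDiffWithinAt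
  filter_upwards [hs.mem_nhds hx] with y hy
  change _ = mfderivWithin I 𝓘(ℝ, F) f s y (X y)
  rw [mfderivWithin_of_isOpen hs hy]
  rfl

end VectorValuedDerivative

/-! ### Tangent vectors in coordinates. -/

section CoordinateDerivatives

variable {n m k : ℕ} {Q : Type*} [TopologicalSpace Q] [ChartedSpace (Eucl n) Q]
  {E : Q → Type*} [∀ q, AddCommGroup (E q)] [∀ q, Module ℝ (E q)]
  [TopologicalSpace (TotalSpace (Eucl m) E)] [∀ q, TopologicalSpace (E q)]
  [FiberBundle (Eucl m) E] [VectorBundle ℝ (Eucl m) E]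
  [ContMDiffVectorBundle ∞ (Eucl m) E (𝓡 n)]
  {c : OpenPartialHomeomorph Q (Eucl n)} {e : Fin m → Sec n m E} {U : Set Q}
  (he : IsLocalFrameOn (𝓡 n) (Eucl m) ∞ (fun α q => e α q) U)

theorem eventually_proj_mem (hU : IsOpen U) {x : Phase m k E} (hx : x.2.proj ∈ U) :
    ∀ᶠ y : Phase m k E in 𝓝 x, y.2.proj ∈ U :=
  ((FiberBundle.continuous_proj (Fin k → Eucl m) (WhitneySum k E)).comp
    continuous_snd).continuousAt.preimage_mem_nhds (hU.mem_nhds hx)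

theorem mdifferentiableAt_coordMap (hc : c ∈ IsManifold.maximalAtlas (𝓡 n) ∞ Q) (hU : IsOpen U)
    (hUc : U ⊆ c.source) {x : Phase m k E} (hx : x.2.proj ∈ U) :
    MDifferentiableAt (phaseModel n m k) 𝓘(ℝ, PhaseCoord n m k) (coordMap c he) x :=
  (contMDiffAt_coordMap he hc hU hUc hx).mdifferentiableAt (by simp)

omit [ContMDiffVectorBundle ∞ (Eucl m) E (𝓡 n)] in
theorem mdifferentiableAt_coordInv (hc : c ∈ IsManifold.maximalAtlas (𝓡 n) ∞ Q)
    (hUc : U ⊆ c.source) {x : Phase m k E} (hx : x.2.proj ∈ U) :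
    MDifferentiableAt 𝓘(ℝ, PhaseCoord n m k) (phaseModel n m k) (coordInv c e)
      (coordMap c he x) :=
  (contMDiffAt_coordInv hc (c.map_source (hUc hx))).mdifferentiableAt (by simp)

variable {F : Type*} [NormedAddCommGroup F] [NormedSpace ℝ F]

/-- Coordinate expression of a derivative. -/
theorem mvfderiv_eq_coord (hc : c ∈ IsManifold.maximalAtlas (𝓡 n) ∞ Q) (hU : IsOpen U)
    (hUc : U ⊆ c.source) {x : Phase m k E} (hx : x.2.proj ∈ U) {f : Phase m k E → F}
    {g : PhaseCoord n m k → F} (hg : DifferentiableAt ℝ g (coordMap c he x))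
    (hfg : ∀ y : Phase m k E, y.2.proj ∈ U → f y = g (coordMap c he y))
    (v : TangentSpace (phaseModel n m k) x) :
    mvfderiv (phaseModel n m k) f x v =
      fderiv ℝ g (coordMap c he x) (mvfderiv (phaseModel n m k) (coordMap c he) x v) := by
  have h : f =ᶠ[𝓝 x] fun y => g (coordMap c he y) := (eventually_proj_mem hU hx).mono hfg
  rw [h.mvfderiv_eq, fderiv_comp_mvfderiv hg (mdifferentiableAt_coordMap he hc hU hUc hx)]

/-- Differentiating the two local identities between `coordMap` and `coordInv` provides a two-sided
inverse. Tangent vectors can thus be prescribed by their coordinates. -/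
theorem isInvertible_mfderiv_coordMap (hc : c ∈ IsManifold.maximalAtlas (𝓡 n) ∞ Q) (hU : IsOpen U)
    (hUc : U ⊆ c.source) {x : Phase m k E} (hx : x.2.proj ∈ U) :
    (mfderiv (phaseModel n m k) 𝓘(ℝ, PhaseCoord n m k) (coordMap c he) x).IsInvertible := by
  have h1 := mdifferentiableAt_coordMap he hc hU hUc hx
  have h2 := mdifferentiableAt_coordInv he hc hUc hx
  have hx' : coordInv c e (coordMap c he x) = x := coordInv_coordMap he hUc hx
  have h1' := h1
  rw [← hx'] at h1'
  have h3 : mfderiv (phaseModel n m k) (phaseModel n m k) (coordInv c e ∘ coordMap c he) x =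
      ContinuousLinearMap.id ℝ _ := by
    rw [← mfderiv_id]
    refine Filter.EventuallyEq.mfderiv_eq ?_
    exact (eventually_proj_mem hU hx).mono fun y hy => coordInv_coordMap he hUc hy
  have h4 : mfderiv 𝓘(ℝ, PhaseCoord n m k) 𝓘(ℝ, PhaseCoord n m k) (coordMap c he ∘ coordInv c e)
      (coordMap c he x) = ContinuousLinearMap.id ℝ _ := by
    rw [← mfderiv_id]
    refine Filter.EventuallyEq.mfderiv_eq ?_
    have hw : ∀ᶠ w : PhaseCoord n m k in 𝓝 (coordMap c he x), w.2.1 ∈ c.target ∩ c.symm ⁻¹' U :=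
      (continuous_fst.comp continuous_snd).continuousAt.preimage_mem_nhds
        ((c.isOpen_inter_preimage_symm hU).mem_nhds
          ⟨c.map_source (hUc hx), by simpa [coordMap, c.left_inv (hUc hx)] using hx⟩)
    exact hw.mono fun w hw => coordMap_coordInv he hw.1 hw.2
  rw [mfderiv_comp x h2 h1] at h3
  rw [mfderiv_comp _ h1' h2] at h4
  refine ContinuousLinearMap.IsInvertible.of_inverse
    (g := mfderiv 𝓘(ℝ, PhaseCoord n m k) (phaseModel n m k) (coordInv c e) (coordMap c he x))
    ?_ h3
  rw [hx'] at h4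
  exact h4

theorem mvfderiv_coordMap_injective (hc : c ∈ IsManifold.maximalAtlas (𝓡 n) ∞ Q) (hU : IsOpen U)
    (hUc : U ⊆ c.source) {x : Phase m k E} (hx : x.2.proj ∈ U) :
    Injective (mvfderiv (phaseModel n m k) (coordMap c he) x) :=
  (isInvertible_mfderiv_coordMap he hc hU hUc hx).injective

theorem dt_eq_coord (hc : c ∈ IsManifold.maximalAtlas (𝓡 n) ∞ Q) (hU : IsOpen U)
    (hUc : U ⊆ c.source) {x : Phase m k E} (hx : x.2.proj ∈ U) (C : Fin k)
    (v : TangentSpace (phaseModel n m k) x) :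
    dt C x v = (mvfderiv (phaseModel n m k) (coordMap c he) x v).1 C := by
  let l : PhaseCoord n m k →L[ℝ] ℝ :=
    (EuclideanSpace.proj C).comp (ContinuousLinearMap.fst ℝ _ _)
  have h := mvfderiv_eq_coord he hc hU hUc hx (f := fun y => y.1 C) (g := l)
    l.differentiableAt (fun _ _ => rfl) v
  rwa [ContinuousLinearMap.fderiv] at h

/-- This turns the compatibility ρ(a) = Tπ(v) into an equation for the q-slot of the coordinate
vector of v. -/
theorem mvfderiv_chart_tangentProj (hc : c ∈ IsManifold.maximalAtlas (𝓡 n) ∞ Q) (hU : IsOpen U)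
    (hUc : U ⊆ c.source) {x : Phase m k E} (hx : x.2.proj ∈ U)
    (v : TangentSpace (phaseModel n m k) x) :
    mvfderiv (𝓡 n) c x.2.proj (tangentProj x v) =
      (mvfderiv (phaseModel n m k) (coordMap c he) x v).2.1 := by
  let l : PhaseCoord n m k →L[ℝ] Eucl n :=
    (ContinuousLinearMap.fst ℝ _ _).comp (ContinuousLinearMap.snd ℝ _ _)
  have h := mvfderiv_eq_coord he hc hU hUc hx (f := fun y => c y.2.proj) (g := l)
    l.differentiableAt (fun _ _ => rfl) v
  rw [ContinuousLinearMap.fderiv] at h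
  exact (mvfderiv_comp_mfderiv (f := fun y : Phase m k E => y.2.proj) (g := c)
    ((contMDiffAt_of_mem_maximalAtlas hc (hUc hx)).mdifferentiableAt (by simp))
    ((Phase.contMDiff_proj x).mdifferentiableAt (by simp)) v).symm.trans h

/-- In coordinates the curve defining the vertical vector is affine in s, so its velocity is its
direction. -/
theorem mvfderiv_coordMap_verticalVector (hc : c ∈ IsManifold.maximalAtlas (𝓡 n) ∞ Q)
    (hU : IsOpen U) (hUc : U ⊆ c.source) {x : Phase m k E} (hx : x.2.proj ∈ U) (A : Fin k)
    (a : Fin k → E x.2.proj) :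
    mvfderiv (phaseModel n m k) (coordMap c he) x (verticalVector A x a) =
      (0, 0, Pi.single A fun α => he.coeff α x.2.proj (a A)) := by
  let g : ℝ → Phase m k E := fun s : ℝ =>
    ((x.1, ⟨x.2.proj, Function.update x.2.snd A (x.2.snd A + s • a A)⟩) : Phase m k E)
  let w : PhaseCoord n m k := (0, 0, Pi.single A fun α => he.coeff α x.2.proj (a A))
  have hg0 : g 0 = x := by simp [g]
  have hg : MDifferentiableAt 𝓘(ℝ, ℝ) (phaseModel n m k) g 0 :=
    (contMDiff_verticalCurve A x a).mdifferentiableAt (by simp)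
  have h1 := mdifferentiableAt_coordMap he hc hU hUc hx
  rw [← hg0] at h1
  have h2 := mvfderiv_comp_mfderiv h1 hg (1 : ℝ)
  have h3 : (fun s => coordMap c he (g s)) = fun s : ℝ => coordMap c he x + s • w := by
    funext s
    refine Prod.ext (by simp [coordMap, g, w]) (Prod.ext (by simp [coordMap, g, w]) ?_)
    funext B α
    by_cases h : B = A
    · subst h; simp [coordMap, g, w]
    · simp [coordMap, g, w, h]
  have h4 : HasFDerivAt (fun s : ℝ => coordMap c he x + s • w)
      ((ContinuousLinearMap.id ℝ ℝ).smulRight w) 0 :=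
    ((ContinuousLinearMap.id ℝ ℝ).smulRight w).hasFDerivAt.const_add _
  rw [h3, mvfderiv_eq_fderiv, h4.fderiv] at h2
  have h5 : mvfderiv (phaseModel n m k) (coordMap c he) (g 0)
      (mfderiv 𝓘(ℝ, ℝ) (phaseModel n m k) g 0 (1 : ℝ)) =
      mvfderiv (phaseModel n m k) (coordMap c he) x (verticalVector A x a) := by
    rw [hg0]; rfl
  rw [← h5, ← h2]
  simp [w]

end CoordinateDerivatives

/-! ### The Poincaré–Cartan sections and the energy in coordinates. -/

section CoordinateForms

variable {n m k : ℕ} {Q : Type*} [TopologicalSpace Q] [ChartedSpace (Eucl n) Q]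
  {E : Q → Type*} [∀ q, AddCommGroup (E q)] [∀ q, Module ℝ (E q)]
  [TopologicalSpace (TotalSpace (Eucl m) E)] [∀ q, TopologicalSpace (E q)]
  [FiberBundle (Eucl m) E] [VectorBundle ℝ (Eucl m) E]
  [ContMDiffVectorBundle ∞ (Eucl m) E (𝓡 n)]
  {c : OpenPartialHomeomorph Q (Eucl n)} {e : Fin m → Sec n m E} {U : Set Q}
  (he : IsLocalFrameOn (𝓡 n) (Eucl m) ∞ (fun α q => e α q) U)
  {L : Phase m k E → ℝ}

variable (c e L) in
/-- The Lagrangian in coordinates. -/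
def coordL (w : PhaseCoord n m k) : ℝ := L (coordInv c e w)

variable (n k) in
/-- The vertical coordinate vector with components `u` in the slot `A`. -/
def vertCoord (A : Fin k) (u : Fin m → ℝ) : PhaseCoord n m k := (0, 0, Pi.single A u)

/-- Used to merge the terms of the k slots, after summing over A, into one vertical argument of D²ℓ.
-/
theorem sum_vertCoord (y : Fin k → Fin m → ℝ) :
    ∑ A, vertCoord n k A (y A) = ((0, 0, y) : PhaseCoord n m k) := by
  have h : ∀ A, vertCoord n k A (y A) = ((LinearMap.inr ℝ (Eucl k) _).comp
      (LinearMap.inr ℝ (Eucl n) (Fin k → Fin m → ℝ))) (Pi.single A (y A)) := fun A => rfl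
  simp_rw [h]
  rw [← map_sum, Finset.univ_sum_single]
  rfl

omit [VectorBundle ℝ (Eucl m) E] [ContMDiffVectorBundle ∞ (Eucl m) E (𝓡 n)] in
theorem coordL_coordMap (hUc : U ⊆ c.source) {x : Phase m k E} (hx : x.2.proj ∈ U) :
    coordL c e L (coordMap c he x) = L x := by
  rw [coordL, coordInv_coordMap he hUc hx]

variable (hL : ContMDiff (phaseModel n m k) 𝓘(ℝ, ℝ) ∞ L)

omit [ContMDiffVectorBundle ∞ (Eucl m) E (𝓡 n)] in
include hL in
theorem contDiffAt_coordL (hc : c ∈ IsManifold.maximalAtlas (𝓡 n) ∞ Q)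
    {w : PhaseCoord n m k} (hw : w.2.1 ∈ c.target) : ContDiffAt ℝ ∞ (coordL c e L) w :=
  ((hL _).comp w (contMDiffAt_coordInv (e := e) hc hw)).contDiffAt

variable (hc : c ∈ IsManifold.maximalAtlas (𝓡 n) ∞ Q) (hU : IsOpen U) (hUc : U ⊆ c.source)
  {x : Phase m k E} (hx : x.2.proj ∈ U)

include hL hc hUc hx in
theorem contDiffAt_coordL_coordMap : ContDiffAt ℝ ∞ (coordL c e L) (coordMap c he x) :=
  contDiffAt_coordL hL hc (c.map_source (hUc hx))

include hL hc hUc hx in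
theorem hasFDerivAt_coordL : HasFDerivAt (coordL c e L)
    (fderiv ℝ (coordL c e L) (coordMap c he x)) (coordMap c he x) :=
  ((contDiffAt_coordL_coordMap he hL hc hUc hx).differentiableAt (by simp)).hasFDerivAt

include hL hc hUc hx in
theorem hasFDerivAt_fderiv_coordL : HasFDerivAt (fderiv ℝ (coordL c e L))
    (fderiv ℝ (fderiv ℝ (coordL c e L)) (coordMap c he x)) (coordMap c he x) :=
  (((contDiffAt_coordL_coordMap he hL hc hUc hx).fderiv_right (m := ∞) (by simp)).differentiableAt
    (by simp)).hasFDerivAt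

include hL hc hU hUc hx

theorem mvfderiv_L_eq_coord (v : TangentSpace (phaseModel n m k) x) :
    mvfderiv (phaseModel n m k) L x v = fderiv ℝ (coordL c e L) (coordMap c he x)
      (mvfderiv (phaseModel n m k) (coordMap c he) x v) :=
  mvfderiv_eq_coord he hc hU hUc hx (hasFDerivAt_coordL he hL hc hUc hx).differentiableAt
    (fun _ hy => (coordL_coordMap he hUc hy).symm) v

theorem dFun_verticalLift_eq_coord (A : Fin k) (a : Fin k → E x.2.proj) :
    dFun A L x (verticalLift (n := n) A x a) = fderiv ℝ (coordL c e L) (coordMap c he x)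
      (vertCoord n k A fun α => he.coeff α x.2.proj (a A)) := by
  have h : (verticalLift (n := n) A x a).2 A = verticalVector A x a := Pi.single_eq_same _ _
  rw [dFun, h, mvfderiv_L_eq_coord he hL hc hU hUc hx,
    mvfderiv_coordMap_verticalVector he hc hU hUc hx]
  rfl

/-- The local form (∂L/∂y^α_A) a^α_A: only the algebroid component a_A matters, not the tangent
vectors. -/
theorem thetaL_eq_coord (A : Fin k) (z : KPair n x) :
    thetaL L A x z = fderiv ℝ (coordL c e L) (coordMap c he x)
      (vertCoord n k A fun α => he.coeff α x.2.proj (z.1 A)) :=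
  dFun_verticalLift_eq_coord he hL hc hU hUc hx A z.1

/-- The Liouville vectors of the k slots add up to the Euler field (0, 0, y). -/
theorem energy_eq_coord : energy n L x =
    fderiv ℝ (coordL c e L) (coordMap c he x) (0, 0, (coordMap c he x).2.2) -
      coordL c e L (coordMap c he x) := by
  rw [energy, coordL_coordMap he hUc hx, ← sum_vertCoord, map_sum]
  congr 1
  exact Finset.sum_congr rfl fun A _ => dFun_verticalLift_eq_coord he hL hc hU hUc hx A _

omit hU in
theorem dLdt_eq_coord (C : Fin k) : dLdt L C x =
    fderiv ℝ (coordL c e L) (coordMap c he x) (EuclideanSpace.single C 1, 0, 0) := by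
  let i : Eucl k → PhaseCoord n m k := fun t => (t, (coordMap c he x).2)
  have hi : HasFDerivAt i (ContinuousLinearMap.inl ℝ _ _) x.1 := hasFDerivAt_prodMk_left _ _
  have h1 : (fun t => L (t, x.2)) = fun t => coordL c e L (i t) := by
    funext t
    exact (coordL_coordMap he (x := (t, x.2)) hUc hx).symm
  rw [dLdt, h1]
  have h2 : HasFDerivAt (coordL c e L) (fderiv ℝ (coordL c e L) (coordMap c he x)) (i x.1) :=
    hasFDerivAt_coordL he hL hc hUc hx
  have h3 : HasFDerivAt (fun t => coordL c e L (i t)) _ x.1 := h2.comp x.1 hi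
  rw [h3.fderiv]
  rfl

/-- By the product rule, differentiating Dℓ(w)(0,0,y) − ℓ(w) along u gives D²ℓ(u, (0,0,y)) +
Dℓ(0,0,u_y) − Dℓ(u). The y-part of Dℓ(u) cancels here, and the t-part is cancelled by the added
∂L/∂t^C terms, so only the q-part survives. -/
theorem mvfderiv_energy_eq_coord (v : TangentSpace (phaseModel n m k) x) :
    mvfderiv (phaseModel n m k) (energy n L) x v + ∑ C, dLdt L C x * dt C x v =
      fderiv ℝ (fderiv ℝ (coordL c e L)) (coordMap c he x)
          (mvfderiv (phaseModel n m k) (coordMap c he) x v) (0, 0, (coordMap c he x).2.2) -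
        fderiv ℝ (coordL c e L) (coordMap c he x)
          (0, (mvfderiv (phaseModel n m k) (coordMap c he) x v).2.1, 0) := by
  set w := coordMap c he x with hw
  set u := mvfderiv (phaseModel n m k) (coordMap c he) x v with hu
  -- The projection onto the y-slot; with it the energy is w ↦ Dℓ(w)(j w) − ℓ(w).
  let j : PhaseCoord n m k →L[ℝ] PhaseCoord n m k :=
    (ContinuousLinearMap.inr ℝ _ _).comp ((ContinuousLinearMap.inr ℝ _ _).comp
      ((ContinuousLinearMap.snd ℝ _ _).comp (ContinuousLinearMap.snd ℝ _ _)))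
  have hg := ((hasFDerivAt_fderiv_coordL he hL hc hUc hx).clm_apply j.hasFDerivAt).sub
    (hasFDerivAt_coordL he hL hc hUc hx)
  rw [mvfderiv_eq_coord he hc hU hUc hx hg.differentiableAt
    (fun y hy => energy_eq_coord he hL hc hU hUc hy), hg.fderiv]
  have h1 : ∑ C, dLdt L C x * dt C x v = fderiv ℝ (coordL c e L) w (u.1, 0, 0) := by
    have h2 : ((u.1, 0, 0) : PhaseCoord n m k) =
        ∑ C, u.1 C • ((EuclideanSpace.single C 1, 0, 0) : PhaseCoord n m k) := by
      have h3 : ∀ C, ((EuclideanSpace.single C 1, 0, 0) : PhaseCoord n m k) =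
        LinearMap.inl ℝ (Eucl k) _ (EuclideanSpace.single C (1 : ℝ)) := fun C => rfl
      simp_rw [h3, ← map_smul, ← map_sum]
      change _ = ((_, 0, 0) : PhaseCoord n m k)
      congr 1
      ext i
      simp [Finset.sum_apply, Pi.single_apply]
    rw [h2, map_sum]
    refine Finset.sum_congr rfl fun C _ => ?_
    rw [dLdt_eq_coord he hL hc hUc hx, dt_eq_coord he hc hU hUc hx, map_smul, smul_eq_mul,
      mul_comm]
  rw [h1]
  have h4 : u = (u.1, 0, 0) + (0, u.2.1, 0) + j u := by simp [j]
  have h5 := congrArg (fderiv ℝ (coordL c e L) w) h4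
  rw [map_add, map_add] at h5
  have h6 : j w = (0, 0, w.2.2) := rfl
  simp only [sub_apply, add_apply,
    ContinuousLinearMap.comp_apply, ContinuousLinearMap.flip_apply, ← hw, ← hu, h6]
  linarith

end CoordinateForms

/-! ### Projectable sections with constant frame components, and Ω_L on them. -/

section FieldEquationsInCoordinates

variable {n m k : ℕ} {Q : Type*} [TopologicalSpace Q] [ChartedSpace (Eucl n) Q]
  {E : Q → Type*} [∀ q, AddCommGroup (E q)] [∀ q, Module ℝ (E q)]
  [TopologicalSpace (TotalSpace (Eucl m) E)] [∀ q, TopologicalSpace (E q)]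
  [FiberBundle (Eucl m) E] [VectorBundle ℝ (Eucl m) E]
  {c : OpenPartialHomeomorph Q (Eucl n)} {e : Fin m → Sec n m E} {U : Set Q}

variable (e) in
/-- The section with constant components `f` in the frame `e`. -/
def frameSection (f : Fin m → ℝ) : Sec n m E := ∑ α, f α • e α

theorem frameSection_apply (f : Fin m → ℝ) (q : Q) : frameSection e f q = ∑ α, f α • e α q := by
  have h := map_sum (ContMDiffSection.coeAddHom (𝓡 n) (Eucl m) ∞ E) (fun α => f α • e α)
    Finset.univ
  have h' := congrFun h q
  rw [Finset.sum_apply] at h'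
  exact h'

variable [ContMDiffVectorBundle ∞ (Eucl m) E (𝓡 n)]
  (he : IsLocalFrameOn (𝓡 n) (Eucl m) ∞ (fun α q => e α q) U)

omit [ContMDiffVectorBundle ∞ (Eucl m) E (𝓡 n)] in
include he in
theorem coeff_frameSection {q : Q} (hq : q ∈ U) (f : Fin m → ℝ) (α : Fin m) :
    he.coeff α q (frameSection e f q) = f α := by
  rw [frameSection_apply]
  exact he.coeff_sum hq f α

omit [ContMDiffVectorBundle ∞ (Eucl m) E (𝓡 n)] in
include he in
theorem frameSection_coeff {q : Q} (hq : q ∈ U) (a : E q) :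
    frameSection e (fun α => he.coeff α q a) q = a := by
  rw [frameSection_apply]
  have := (he.toBasisAt hq).sum_repr a
  simpa [IsLocalFrameOn.coeff, hq] using this

variable [IsManifold (𝓡 n) ∞ Q] (D : LieAlgebroid n m E)

omit [ContMDiffVectorBundle ∞ (Eucl m) E (𝓡 n)] in
theorem contMDiffOn_anchor_chart (hc : c ∈ IsManifold.maximalAtlas (𝓡 n) ∞ Q) (σ : Sec n m E) :
    ContMDiffOn (𝓡 n) 𝓘(ℝ, Eucl n) ∞ (fun q => mvfderiv (𝓡 n) c q (D.anchor q (σ q))) c.source :=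
  (contMDiffOn_of_mem_maximalAtlas hc).mvfderiv_apply c.open_source
    (D.contMDiff_anchor.comp σ.contMDiff).contMDiffOn

omit [IsManifold (𝓡 n) ∞ Q] in
theorem mvfderiv_chart_injective (hc : c ∈ IsManifold.maximalAtlas (𝓡 n) ∞ Q) {q : Q}
    (hq : q ∈ c.source) : Injective (mvfderiv (𝓡 n) c q) := by
  have h1 := (contMDiffAt_of_mem_maximalAtlas hc hq).mdifferentiableAt (by simp)
  have h2 := (contMDiffAt_symm_of_mem_maximalAtlas hc (c.map_source hq)).mdifferentiableAt
    (by simp)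
  have h3 : mfderiv (𝓡 n) (𝓡 n) (c.symm ∘ c) q = ContinuousLinearMap.id ℝ _ := by
    rw [← mfderiv_id]
    refine Filter.EventuallyEq.mfderiv_eq ?_
    filter_upwards [c.open_source.mem_nhds hq] with y hy using c.left_inv hy
  rw [mfderiv_comp q h2 h1] at h3
  intro v w hvw
  have h4 : ∀ v, mfderiv (𝓡 n) (𝓡 n) c.symm (c q) (mfderiv (𝓡 n) (𝓡 n) c q v) = v :=
    fun v => congrArg (fun l : TangentSpace (𝓡 n) q →L[ℝ] TangentSpace (𝓡 n) q => l v) h3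
  rw [← h4 v, ← h4 w]
  exact congrArg _ hvw

variable (hc : c ∈ IsManifold.maximalAtlas (𝓡 n) ∞ Q) (hU : IsOpen U) (hUc : U ⊆ c.source)
  {x : Phase m k E} (hx : x.2.proj ∈ U)

include he hc hU hUc hx in
/-- There are projectable sections with given value at a point and constant components in the
frame. -/
theorem exists_projectableSection (f : Fin k → Fin m → ℝ)
    (v : Fin k → TangentSpace (phaseModel n m k) x)
    (hv : ∀ A, D.anchor x.2.proj (frameSection e (f A) x.2.proj) = tangentProj x (v A)) :
    ∃ Z : ProjectableSection D ((fun y : Phase m k E => y.2.proj) ⁻¹' U),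
      (∀ A, Z.σ A = frameSection e (f A)) ∧ ∀ A, Z.X A x = v A := by
  let V : Fin k → PhaseCoord n m k := fun A =>
    mvfderiv (phaseModel n m k) (coordMap c he) x (v A)
  let r : Fin k → Q → Eucl n := fun A q =>
    mvfderiv (𝓡 n) c q (D.anchor q (frameSection e (f A) q))
  -- The t- and y-slots are frozen at their values at `x`. The q-slot is forced at every point by
  -- relatedness to the section of `E`; at `x` it agrees with the prescribed vector by `hv`.
  let Y : Fin k → ∀ w : PhaseCoord n m k, TangentSpace 𝓘(ℝ, PhaseCoord n m k) w :=
    fun A w => (((V A).1, r A (c.symm w.2.1), (V A).2.2) : PhaseCoord n m k)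
  let X : Fin k → ∀ y : Phase m k E, TangentSpace (phaseModel n m k) y := fun A =>
    VectorField.mpullback (phaseModel n m k) 𝓘(ℝ, PhaseCoord n m k) (coordMap c he) (Y A)
  have hX : ∀ A (y : Phase m k E), y.2.proj ∈ U →
      mvfderiv (phaseModel n m k) (coordMap c he) y (X A y) =
        ((V A).1, r A y.2.proj, (V A).2.2) := by
    intro A y hy
    have h1 := (isInvertible_mfderiv_coordMap he hc hU hUc hy).self_apply_inverse
      (Y A (coordMap c he y))
    have h2 : Y A (coordMap c he y) = (((V A).1, r A y.2.proj, (V A).2.2) : PhaseCoord n m k) :=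
      congrArg (fun q => (((V A).1, r A q, (V A).2.2) : PhaseCoord n m k)) (c.left_inv (hUc hy))
    exact h1.trans h2
  refine ⟨⟨fun A => frameSection e (f A), X, ?_, ?_⟩, fun A => rfl, fun A => ?_⟩
  · intro A y hy
    have hYs : ContDiffAt ℝ ∞ (fun w : PhaseCoord n m k =>
        (((V A).1, r A (c.symm w.2.1), (V A).2.2) : PhaseCoord n m k)) (coordMap c he y) := by
      refine contDiffAt_const.prodMk (ContDiffAt.prodMk ?_ contDiffAt_const)
      have hq : c.symm (coordMap c he y).2.1 ∈ c.source := c.map_target (c.map_source (hUc hy))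
      have h1 := (contMDiffOn_anchor_chart D hc (frameSection e (f A))).contMDiffAt
        (c.open_source.mem_nhds hq)
      have h2 : ContMDiffAt 𝓘(ℝ, PhaseCoord n m k) (𝓡 n) ∞
          (fun w : PhaseCoord n m k => c.symm w.2.1) (coordMap c he y) :=
        ContMDiffAt.comp (g := c.symm) (coordMap c he y)
          (contMDiffAt_symm_of_mem_maximalAtlas hc (c.map_source (hUc hy)))
          (contDiff_fst.comp contDiff_snd).contMDiff.contMDiffAt
      exact (ContMDiffAt.comp (f := fun w : PhaseCoord n m k => c.symm w.2.1) (g := r A) _ h1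
        h2).contDiffAt
    have h3 := contMDiffAt_vectorSpace_iff_contDiffAt (V := Y A).2 hYs
    have : IsManifold (phaseModel n m k) 1 (Phase m k E) := IsManifold.of_le (n := ∞) (by simp)
    exact (ContMDiffAt.mpullback_vectorField_preimage h3 (contMDiffAt_coordMap he hc hU hUc hy)
      (isInvertible_mfderiv_coordMap he hc hU hUc hy) (by simp)).contMDiffWithinAt
  · intro A y hy
    refine mvfderiv_chart_injective hc (hUc hy) ?_
    rw [mvfderiv_chart_tangentProj he hc hU hUc hy, hX A y hy]
  · refine mvfderiv_coordMap_injective he hc hU hUc hx ?_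
    change _ = V A
    rw [hX A x hx]
    refine Prod.ext rfl (Prod.ext ?_ rfl)
    change mvfderiv (𝓡 n) c x.2.proj (D.anchor x.2.proj (frameSection e (f A) x.2.proj)) = _
    rw [hv A, mvfderiv_chart_tangentProj he hc hU hUc hx]

variable {L : Phase m k E → ℝ} (hL : ContMDiff (phaseModel n m k) 𝓘(ℝ, ℝ) ∞ L)

include hc hU hUc hx hL in
-- Since the components f, f' are constant, differentiating Θ_L^A(Z) only hits Dℓ. Besides these
-- second derivatives of ℓ there remains Θ_L^A of the bracket, which sees only the bracket in `E`.
theorem omegaL_eq_coord {D : LieAlgebroid n m E}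
    {Z Z' : ProjectableSection D ((fun y : Phase m k E => y.2.proj) ⁻¹' U)}
    {f f' : Fin k → Fin m → ℝ} (hZ : ∀ A, Z.σ A = frameSection e (f A))
    (hZ' : ∀ A, Z'.σ A = frameSection e (f' A)) (A : Fin k) :
    omegaL L A Z Z' x =
      fderiv ℝ (fderiv ℝ (coordL c e L)) (coordMap c he x)
          (mvfderiv (phaseModel n m k) (coordMap c he) x (Z'.X A x)) (vertCoord n k A (f A)) -
        fderiv ℝ (fderiv ℝ (coordL c e L)) (coordMap c he x)
          (mvfderiv (phaseModel n m k) (coordMap c he) x (Z.X A x)) (vertCoord n k A (f' A)) +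
      fderiv ℝ (coordL c e L) (coordMap c he x) (vertCoord n k A fun γ =>
        he.coeff γ x.2.proj (D.bracket (frameSection e (f A)) (frameSection e (f' A)) x.2.proj)) := by
  -- The derivative of Θ_L^A(W) in the direction v, for either section.
  have key : ∀ (W : ProjectableSection D ((fun y : Phase m k E => y.2.proj) ⁻¹' U))
      (g : Fin k → Fin m → ℝ), (∀ A, W.σ A = frameSection e (g A)) →
      ∀ v, mvfderiv (phaseModel n m k) (fun y => thetaL L A y (W.eval y)) x v =
        fderiv ℝ (fderiv ℝ (coordL c e L)) (coordMap c he x)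
          (mvfderiv (phaseModel n m k) (coordMap c he) x v) (vertCoord n k A (g A)) := by
    intro W g hW v
    have hg := (hasFDerivAt_fderiv_coordL he hL hc hUc hx).clm_apply
      (hasFDerivAt_const (vertCoord n k A (g A)) _)
    rw [mvfderiv_eq_coord he hc hU hUc hx hg.differentiableAt, hg.fderiv]
    · simp
    · intro y hy
      rw [thetaL_eq_coord he hL hc hU hUc hy]
      congr 2
      funext α
      change he.coeff α y.2.proj (W.σ A y.2.proj) = _
      rw [hW, coeff_frameSection he hy]
  rw [omegaL, dOne, dFun, dFun, key Z' f' hZ', key Z f hZ, thetaL_eq_coord he hL hc hU hUc hx]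
  simp only [ProjectableSection.bracket, ProjectableSection.eval, hZ, hZ']
  ring

end FieldEquationsInCoordinates

/-! ### Cut-off functions and frames of global sections. -/

section LocalFrames

variable {n m : ℕ} {Q : Type*} [TopologicalSpace Q] [T2Space Q] [ChartedSpace (Eucl n) Q]
  [IsManifold (𝓡 n) ∞ Q]
  {E : Q → Type*} [∀ q, AddCommGroup (E q)] [∀ q, Module ℝ (E q)]
  [TopologicalSpace (TotalSpace (Eucl m) E)] [∀ q, TopologicalSpace (E q)]
  [FiberBundle (Eucl m) E] [VectorBundle ℝ (Eucl m) E]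
  [ContMDiffVectorBundle ∞ (Eucl m) E (𝓡 n)]

/-- Hausdorffness of `Q` enters here: it makes a bump function of a chart, extended by zero, smooth
on all of `Q`. -/
theorem exists_bump {U : Set Q} {q : Q} (hU : U ∈ 𝓝 q) :
    ∃ χ : Q → ℝ, ContMDiff (𝓡 n) 𝓘(ℝ, ℝ) ∞ χ ∧ tsupport χ ⊆ U ∧ χ =ᶠ[𝓝 q] 1 := by
  obtain ⟨χ, hχ, -⟩ := (SmoothBumpFunction.nhds_basis_support (I := 𝓡 n) hU).mem_iff.1 hU
  exact ⟨χ, χ.contMDiff, hχ, χ.eventuallyEq_one⟩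

variable (n m E) in
/-- Near every point there is a frame made of global sections. -/
theorem exists_localFrame (q : Q) : ∃ (U : Set Q) (e : Fin m → Sec n m E), IsOpen U ∧ q ∈ U ∧
    U ⊆ (chartAt (Eucl n) q).source ∧
    IsLocalFrameOn (𝓡 n) (Eucl m) ∞ (fun α q => e α q) U := by
  let T := trivializationAt (Eucl m) E q
  let b := (EuclideanSpace.basisFun (Fin m) ℝ).toBasis
  have hT : T.baseSet ∈ 𝓝 q := T.open_baseSet.mem_nhds (FiberBundle.mem_baseSet_trivializationAt' q)
  obtain ⟨χ, hχ, hsupp, h1⟩ := exists_bump (n := n) hT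
  obtain ⟨W, hW1, hW, hqW⟩ := eventually_nhds_iff.1 h1
  -- The frame of the trivialization times the cut-off extends by zero to global sections, and is
  -- unchanged on `W`, where the cut-off is 1.
  have hs : ∀ α, ContMDiff (𝓡 n) ((𝓡 n).prod 𝓘(ℝ, Eucl m)) ∞
      (fun q => (⟨q, (χ • T.localFrame b α) q⟩ : TotalSpace (Eucl m) E)) := fun α =>
    ContMDiffOn.smul_section_of_tsupport hχ.contMDiffOn T.open_baseSet hsupp
      (T.contMDiffOn_localFrame_baseSet ∞ b α)
  refine ⟨W ∩ T.baseSet ∩ (chartAt (Eucl n) q).source, fun α => ⟨_, hs α⟩,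
    (hW.inter T.open_baseSet).inter (chartAt (Eucl n) q).open_source,
    ⟨⟨hqW, FiberBundle.mem_baseSet_trivializationAt' q⟩, mem_chart_source _ q⟩,
    inter_subset_right, ?_⟩
  refine ((T.isLocalFrameOn_localFrame_baseSet (𝓡 n) ∞ b).mono
    (inter_subset_left.trans inter_subset_right)).congr fun α y hy => ?_
  have : χ y = 1 := hW1 y hy.1.1
  change _ = χ y • T.localFrame b α y
  rw [this, one_smul]

end LocalFrames

/-! ### The field equations in coordinates and the SOPDE property. -/

section SOPDE

variable {n m k : ℕ} {Q : Type*} [TopologicalSpace Q] [ChartedSpace (Eucl n) Q]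
  [IsManifold (𝓡 n) ∞ Q]
  {E : Q → Type*} [∀ q, AddCommGroup (E q)] [∀ q, Module ℝ (E q)]
  [TopologicalSpace (TotalSpace (Eucl m) E)] [∀ q, TopologicalSpace (E q)]
  [FiberBundle (Eucl m) E] [VectorBundle ℝ (Eucl m) E]
  [ContMDiffVectorBundle ∞ (Eucl m) E (𝓡 n)]
  {c : OpenPartialHomeomorph Q (Eucl n)} {e : Fin m → Sec n m E} {U : Set Q}
  (he : IsLocalFrameOn (𝓡 n) (Eucl m) ∞ (fun α q => e α q) U)
  {D : LieAlgebroid n m E} {L : Phase m k E → ℝ} {ξ : ProlongationSection k D}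

/-- On a diagonal element the k right-hand sides coincide, and their factors 1/k add up to 1. -/
theorem ProlongationSection.FieldEquations.summed (hk : 1 ≤ k) (h : ξ.FieldEquations L) :
    ξ.SummedFieldEquations L := by
  refine ⟨h.1, fun U hU Z Z' x hx hZ a v hZ' => ?_⟩
  have hk' : (k : ℝ) ≠ 0 := by positivity
  simp_rw [fun A => h.2 A U hU Z Z' x hx hZ, hZ', dFun, yBar]
  rw [Finset.sum_const, Finset.card_univ, Fintype.card_fin, nsmul_eq_mul, ← mul_assoc,
    mul_one_div_cancel hk', one_mul]

variable (hc : c ∈ IsManifold.maximalAtlas (𝓡 n) ∞ Q) (hU : IsOpen U) (hUc : U ⊆ c.source)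
  {x : Phase m k E} (hx : x.2.proj ∈ U) (hL : ContMDiff (phaseModel n m k) 𝓘(ℝ, ℝ) ∞ L)

include hc hU hUc hx hL in
/-- The summed field equations in coordinates. -/
theorem ProlongationSection.SummedFieldEquations.coord (h : ξ.SummedFieldEquations L)
    (f' : Fin m → ℝ) (w : PhaseCoord n m k)
    (hw : mvfderiv (𝓡 n) c x.2.proj (D.anchor x.2.proj (frameSection e f' x.2.proj)) = w.2.1) :
    ∑ A, (fderiv ℝ (fderiv ℝ (coordL c e L)) (coordMap c he x) w
          (vertCoord n k A fun α => he.coeff α x.2.proj ((ξ.toFun x).1 A)) -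
        fderiv ℝ (fderiv ℝ (coordL c e L)) (coordMap c he x)
          (mvfderiv (phaseModel n m k) (coordMap c he) x ((ξ.toFun x).2 A)) (vertCoord n k A f') +
      fderiv ℝ (coordL c e L) (coordMap c he x) (vertCoord n k A fun γ =>
        he.coeff γ x.2.proj (D.bracket
          (frameSection e fun α => he.coeff α x.2.proj ((ξ.toFun x).1 A))
          (frameSection e f') x.2.proj))) =
    fderiv ℝ (fderiv ℝ (coordL c e L)) (coordMap c he x) w (0, 0, (coordMap c he x).2.2) -
      fderiv ℝ (coordL c e L) (coordMap c he x) (0, w.2.1, 0) := by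
  obtain ⟨v, hv⟩ : ∃ v, mvfderiv (phaseModel n m k) (coordMap c he) x v = w :=
    ⟨_, (isInvertible_mfderiv_coordMap he hc hU hUc hx).self_apply_inverse w⟩
  -- `Z` passes through ξ(x), which is admissible because ξ lies in the prolongation; `Z'` passes
  -- through the diagonal test element with coordinates f' and w.
  obtain ⟨Z, hZσ, hZX⟩ := exists_projectableSection he D hc hU hUc hx
    (fun A α => he.coeff α x.2.proj ((ξ.toFun x).1 A)) (ξ.toFun x).2 (fun A => by
      rw [frameSection_coeff he hx]
      exact ξ.mem x A)
  obtain ⟨Z', hZσ', hZX'⟩ := exists_projectableSection he D hc hU hUc hx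
    (fun _ => f') (fun _ => v) (fun A => by
      refine mvfderiv_chart_injective hc (hUc hx) ?_
      rw [hw, mvfderiv_chart_tangentProj he hc hU hUc hx, hv])
  have h1 := h.2 _ (hU.preimage ((FiberBundle.continuous_proj (Fin k → Eucl m)
    (WhitneySum k E)).comp continuous_snd)) Z Z' x hx ?_ (frameSection e f' x.2.proj) v ?_
  · rw [mvfderiv_energy_eq_coord he hL hc hU hUc hx, hv] at h1
    rw [← h1]
    refine Finset.sum_congr rfl fun A _ => ?_
    rw [omegaL_eq_coord he hc hU hUc hx hL hZσ hZσ', hZX, hZX', hv]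
  · refine Prod.ext (funext fun A => ?_) (funext hZX)
    change Z.σ A x.2.proj = _
    rw [hZσ, frameSection_coeff he hx]
  · refine Prod.ext (funext fun A => ?_) (funext hZX')
    change Z'.σ A x.2.proj = _
    rw [hZσ']

omit [IsManifold (𝓡 n) ∞ Q] in
include hc hUc hx hL in
-- In the basis given by the frame at x, the matrix of the regularity condition is the restriction
-- of D²ℓ to vertical vectors, and u is in its kernel.
theorem IsRegularLagrangian.eq_zero (hreg : IsRegularLagrangian L) (u : Fin k → Fin m → ℝ)
    (hu : ∀ h : Fin k → Fin m → ℝ,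
      fderiv ℝ (fderiv ℝ (coordL c e L)) (coordMap c he x) (0, 0, h) (0, 0, u) = 0) : u = 0 := by
  have hdet := (hreg x (he.toBasisAt hx)).ne_zero
  let j : (Fin k → Fin m → ℝ) →L[ℝ] PhaseCoord n m k :=
    (ContinuousLinearMap.inr ℝ _ _).comp (ContinuousLinearMap.inr ℝ _ _)
  let i : (Fin k → Fin m → ℝ) → PhaseCoord n m k := fun y => (x.1, c x.2.proj, y)
  have hi : ∀ y, HasFDerivAt i j y := fun y => by
    have : i = fun y => (x.1, c x.2.proj, 0) + j y := by
      funext y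
      simp [i, j]
    rw [this]
    exact j.hasFDerivAt.const_add _
  have h1 : (fun y : Fin k → Fin m → ℝ => L (x.1, ⟨x.2.proj, fun A =>
      ∑ α, y A α • he.toBasisAt hx α⟩)) = fun y => coordL c e L (i y) := by
    funext y
    have hy : coordMap c he (x.1, ⟨x.2.proj, fun A => ∑ α, y A α • e α x.2.proj⟩) = i y := by
      refine Prod.ext rfl (Prod.ext rfl ?_)
      funext A α
      exact he.coeff_sum hx _ α
    rw [← hy, coordL_coordMap he (x := (x.1, ⟨x.2.proj, fun A => ∑ α, y A α • e α x.2.proj⟩)) hUc hx]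
    simp only [IsLocalFrameOn.toBasisAt_coe]
  have h2 : ∀ y v, fderiv ℝ (fun y => coordL c e L (i y)) y v =
      fderiv ℝ (coordL c e L) (i y) (j v) := by
    intro y v
    have h3 : HasFDerivAt (coordL c e L) (fderiv ℝ (coordL c e L) (i y)) (i y) :=
      ((contDiffAt_coordL hL hc (c.map_source (hUc hx))).differentiableAt (by simp)).hasFDerivAt
    have h4 : HasFDerivAt (fun y => coordL c e L (i y)) _ y := h3.comp y (hi y)
    rw [h4.fderiv]
    rfl
  have h5 : (fun A α => (he.toBasisAt hx).repr (x.2.snd A) α) = (coordMap c he x).2.2 := by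
    funext A α
    simp [coordMap, IsLocalFrameOn.coeff, hx]
  have h6 : ∀ v w, fderiv ℝ (fun y => fderiv ℝ (coordL c e L) (i y) (j v)) (coordMap c he x).2.2 w =
      fderiv ℝ (fderiv ℝ (coordL c e L)) (coordMap c he x) (j w) (j v) := by
    intro v w
    have h7 : HasFDerivAt (fun y => fderiv ℝ (coordL c e L) (i y) (j v)) _ (coordMap c he x).2.2 :=
      (HasFDerivAt.comp (g := fderiv ℝ (coordL c e L)) (coordMap c he x).2.2
        (hasFDerivAt_fderiv_coordL he hL hc hUc hx) (hi _)).clm_apply (hasFDerivAt_const (j v) _)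
    rw [h7.fderiv]
    simp
  simp only [h1, h2, h5, h6] at hdet
  -- The row index belongs to the inner derivative, the second argument of D²ℓ, so u multiplies from
  -- the left and no symmetry of D²ℓ is needed.
  have h8 := Matrix.eq_zero_of_vecMul_eq_zero hdet (v := fun p => u p.1 p.2) (by
    funext p
    have h9 : (0, 0, u) = j u := rfl
    have h10 : u = ∑ q : Fin k × Fin m, u q.1 q.2 • Pi.single q.1 (Pi.single q.2 (1 : ℝ)) := by
      rw [Fintype.sum_prod_type]
      funext A α
      simp [Finset.sum_apply, Pi.single_apply, ite_apply]
    have h11 := hu (Pi.single p.1 (Pi.single p.2 1))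
    rw [h9] at h11
    nth_rewrite 1 [h10] at h11
    rw [map_sum, map_sum] at h11
    simp only [map_smul, smul_eq_mul] at h11
    exact h11)
  funext A α
  exact congrFun h8 (A, α)

include hc hU hUc hx hL he in
-- Vertical test elements have zero algebroid component, so the terms with ξ_A and with the bracket
-- vanish. The equation says that a − y is in the kernel of the fibre Hessian.
theorem ProlongationSection.SummedFieldEquations.fst_eq (h : ξ.SummedFieldEquations L)
    (hreg : IsRegularLagrangian L) : (ξ.toFun x).1 = x.2.snd := by
  let f : Fin k → Fin m → ℝ := fun A α => he.coeff α x.2.proj ((ξ.toFun x).1 A)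
  have h0 : (frameSection e (0 : Fin m → ℝ)) = 0 := by simp [frameSection]
  have hv0 : ∀ A, vertCoord n k A (0 : Fin m → ℝ) = 0 := fun A => by simp [vertCoord]
  have h1 : f - (coordMap c he x).2.2 = 0 := by
    refine hreg.eq_zero he hc hUc hx hL _ fun w => ?_
    have h2 := h.coord he hc hU hUc hx hL 0 (0, 0, w) (by
      rw [h0]
      change mvfderiv (𝓡 n) c x.2.proj (D.anchor x.2.proj 0) = 0
      rw [map_zero, map_zero])
    have h3 : ((0, 0, f - (coordMap c he x).2.2) : PhaseCoord n m k) =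
        (0, 0, f) - (0, 0, (coordMap c he x).2.2) := by simp
    rw [h3, map_sub, ← sum_vertCoord f, map_sum, sub_eq_zero]
    have h4 : ∀ γ, he.coeff γ x.2.proj ((0 : Sec n m E) x.2.proj) = 0 := fun γ => map_zero _
    have h5 : (fun _ => 0 : Fin m → ℝ) = 0 := rfl
    simp only [h0, map_zero, h4, h5, hv0, sub_zero, add_zero] at h2
    rw [h2, sub_eq_self]
    exact map_zero _
  funext A
  rw [← frameSection_coeff he hx ((ξ.toFun x).1 A),
    ← frameSection_coeff he hx (x.2.snd A)]
  congr 2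
  exact congrFun (sub_eq_zero.1 h1) A

include hL in
theorem ProlongationSection.SummedFieldEquations.isSOPDE [T2Space Q]
    (h : ξ.SummedFieldEquations L) (hreg : IsRegularLagrangian L) : ξ.IsSOPDE := by
  refine ⟨fun A x => ?_, h.1⟩
  obtain ⟨U, e, hU, hx, hUc, he⟩ := exists_localFrame n m E x.2.proj
  rw [verticalEndo, liouville,
    h.fst_eq he (IsManifold.chart_mem_maximalAtlas x.2.proj) hU hUc hx hL hreg]

end SOPDE

/-! ### Differentials of 1-forms and structure functions. -/

section EulerLagrange

variable {n m k : ℕ} {Q : Type*} [TopologicalSpace Q] [ChartedSpace (Eucl n) Q]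
  [IsManifold (𝓡 n) ∞ Q]
  {E : Q → Type*} [∀ q, AddCommGroup (E q)] [∀ q, Module ℝ (E q)]
  [TopologicalSpace (TotalSpace (Eucl m) E)] [∀ q, TopologicalSpace (E q)]
  [FiberBundle (Eucl m) E] [VectorBundle ℝ (Eucl m) E]

namespace LieAlgebroid

variable (D : LieAlgebroid n m E)

theorem bracket_skew (σ τ : Sec n m E) : D.bracket σ τ = -D.bracket τ σ := by
  have h := D.bracket_self (σ + τ)
  simp only [map_add, LinearMap.add_apply, D.bracket_self, zero_add, add_zero] at h
  rw [add_comm] at h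
  exact eq_neg_of_add_eq_zero_left h

/-- The exterior differential of a `1`-form. -/
theorem d_one_form (μ : ∀ q, (E q) [⋀^Fin 1]→ₗ[ℝ] ℝ) (σ : Fin 2 → Sec n m E) (q : Q) :
    D.d μ σ q = mvfderiv (𝓡 n) (fun q' => μ q' (fun _ => σ 1 q')) q (D.anchor q (σ 0 q)) -
      mvfderiv (𝓡 n) (fun q' => μ q' (fun _ => σ 0 q')) q (D.anchor q (σ 1 q)) -
      μ q (fun _ => D.bracket (σ 0) (σ 1) q) := by
  have h0 : ∀ q', (fun r : Fin 1 => σ r.succ q') = fun _ => σ 1 q' := by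
    intro q'; funext r; fin_cases r; rfl
  have h1 : ∀ q', (fun r : Fin 1 => σ ((1 : Fin 2).succAbove r) q') = fun _ => σ 0 q' := by
    intro q'; funext r; fin_cases r; rfl
  have h2 : ∀ g : Fin 0 → E q, (Fin.cons (D.bracket (σ 0) (σ 1) q) g : Fin 1 → E q) =
      fun _ => D.bracket (σ 0) (σ 1) q := by
    intro g; funext r; fin_cases r; rfl
  simp only [d, dBracket]
  simp [h2, sub_eq_add_neg]
  exact congrArg₂ (fun f g => mvfderiv (𝓡 n) f q (D.anchor q (σ 0 q)) +
      -mvfderiv (𝓡 n) g q (D.anchor q (σ 1 q)))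
    (funext fun q' => congrArg (μ q') (h0 q')) (funext fun q' => congrArg (μ q') (h1 q'))

end LieAlgebroid

variable {c : OpenPartialHomeomorph Q (Eucl n)} {e : Fin m → Sec n m E} {U : Set Q}
  (he : IsLocalFrameOn (𝓡 n) (Eucl m) ∞ (fun α q => e α q) U)
  {D : LieAlgebroid n m E}

/-- Constant components make ℝ-bilinearity of the bracket enough; the Leibniz rule is not needed. -/
theorem coeff_bracket_frameSection (f g : Fin m → ℝ) (α : Fin m) (q : Q) :
    he.coeff α q (D.bracket (frameSection e f) (frameSection e g) q) =
      ∑ β, ∑ γ, structC D he α β γ q * f β * g γ := by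
  let ev : Sec n m E →ₗ[ℝ] E q := ⟨⟨fun s => s q, fun _ _ => rfl⟩, fun _ _ => rfl⟩
  change (he.coeff α q) (ev (D.bracket (frameSection e f) (frameSection e g))) = _
  simp only [frameSection, map_sum, map_smul, LinearMap.sum_apply, LinearMap.smul_apply,
    smul_eq_mul, Finset.mul_sum]
  refine (Finset.sum_comm).trans (Finset.sum_congr rfl fun β _ => Finset.sum_congr rfl fun γ _ => ?_)
  change _ = he.coeff α q (ev (D.bracket (e β) (e γ))) * _ * _
  ring

theorem structC_skew (γ α β : Fin m) (q : Q) : structC D he γ α β q = -structC D he γ β α q := by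
  rw [structC, structC, D.bracket_skew]
  exact map_neg (he.coeff γ q) _

omit [IsManifold (𝓡 n) ∞ Q] in
theorem frameSection_single (α : Fin m) : frameSection e (Pi.single α (1 : ℝ)) = e α := by
  simp [frameSection, Pi.single_apply]

variable [ContMDiffVectorBundle ∞ (Eucl m) E (𝓡 n)] [T2Space Q]

/-! ### The Maurer–Cartan equation of a Lie algebroid morphism. -/

section MaurerCartan

variable (Φ : LieAlgebroid.Hom (LieAlgebroid.tangent k (Eucl k)) D)

/-- The coordinate vector fields of `ℝᵏ`. -/
def coordField (A : Fin k) : Sec k k (TangentSpace (𝓡 k) : Eucl k → Type) :=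
  ⟨fun _ => (EuclideanSpace.single A (1 : ℝ) : Eucl k),
    contMDiffOn_univ.1 (contMDiffOn_vectorSpace_iff_contDiffOn.2 contDiffOn_const)⟩

theorem bracket_coordField (A B : Fin k) :
    (LieAlgebroid.tangent k (Eucl k)).bracket (coordField A) (coordField B) = 0 := by
  ext1 t
  change VectorField.mlieBracket (𝓡 k) (coordField A) (coordField B) t = 0
  rw [← VectorField.mlieBracketWithin_univ, VectorField.mlieBracketWithin_eq_lieBracketWithin]
  change VectorField.lieBracketWithin ℝ (fun _ => (EuclideanSpace.single A (1 : ℝ) : Eucl k))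
    (fun _ => (EuclideanSpace.single B (1 : ℝ) : Eucl k)) univ t = 0
  simp [VectorField.lieBracketWithin]

/-- Evaluate dΦ^*μ = Φ^*dμ on ∂_B, ∂_A, with μ the cut-off coframe element e^α. On the left the
coordinate fields commute, so only the two partial derivatives remain. On the right the values
Φ(∂_B), Φ(∂_A) at t are extended with constant components, so only the bracket term remains. -/
theorem LieAlgebroid.Hom.maurerCartan (hU : IsOpen U) {t : Eucl k} (ht : Φ.base t ∈ U)
    (hΦ : ContinuousAt Φ.base t) (A B : Fin k) (α : Fin m) :
    pd B (fun s => he.coeff α (Φ.base s) (Φ.map s (EuclideanSpace.single A (1 : ℝ) : Eucl k))) t -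
      pd A (fun s => he.coeff α (Φ.base s) (Φ.map s (EuclideanSpace.single B (1 : ℝ) : Eucl k))) t =
      -∑ β, ∑ γ, structC D he α β γ (Φ.base t) *
        he.coeff β (Φ.base t) (Φ.map t (EuclideanSpace.single B (1 : ℝ) : Eucl k)) *
        he.coeff γ (Φ.base t) (Φ.map t (EuclideanSpace.single A (1 : ℝ) : Eucl k)) := by
  obtain ⟨χ, hχ, hsupp, h1⟩ := exists_bump (n := n) (hU.mem_nhds ht)
  -- `map_d` requires a form smooth on all of `Q`, while the coefficients are meaningful only on
  -- `U`; hence the factor χ, equal to 1 near `Φ.base t`.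
  let μ : ∀ q, (E q) [⋀^Fin 1]→ₗ[ℝ] ℝ := fun q =>
    AlternatingMap.ofSubsingleton ℝ (E q) ℝ (0 : Fin 1) (χ q • he.coeff α q)
  have hμ : ∀ q (v : Fin 1 → E q), μ q v = χ q * he.coeff α q (v 0) := fun q v => rfl
  have hμs : LieAlgebroid.IsSmoothForm (n := n) (m := m) μ := by
    intro σ
    refine contMDiff_of_tsupport fun q hq => ?_
    have hq' : q ∈ U := by
      refine hsupp (closure_mono (fun q hq => ?_) hq)
      exact left_ne_zero_of_mul hq
    have h2 := IsLocalFrameOn.contMDiffAt_coeff hU he ((σ 0).contMDiff q) hq'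
    exact (hχ q).mul (contMDiffAt_pi_space.1 h2 α)
  let f : Fin k → Fin m → ℝ := fun A β =>
    he.coeff β (Φ.base t) (Φ.map t (EuclideanSpace.single A (1 : ℝ) : Eucl k))
  have h3 := Φ.map_d 1 μ hμs t ![coordField B, coordField A]
    ![frameSection e (f B), frameSection e (f A)] (by
      intro i
      fin_cases i
      · exact frameSection_coeff he ht _
      · exact frameSection_coeff he ht _)
  rw [LieAlgebroid.d_one_form, LieAlgebroid.d_one_form] at h3
  -- Near `Φ.base t` the form takes a constant value on a section with constant components.
  have hconst : ∀ C v, mvfderiv (𝓡 n)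
      (fun q' => μ q' (fun _ => frameSection e (f C) q')) (Φ.base t) v = 0 := by
    intro C v
    have h4 : (fun q' => μ q' (fun _ => frameSection e (f C) q')) =ᶠ[𝓝 (Φ.base t)]
        fun _ => f C α := by
      filter_upwards [h1, hU.mem_nhds ht] with q hq hqU
      rw [hμ, hq, coeff_frameSection he hqU]
      simp
    rw [h4.mvfderiv_eq, mvfderiv_const]
    rfl
  have hpd : ∀ C C', mvfderiv (𝓡 k) (fun s => (μ (Φ.base s)).compLinearMap (Φ.map s)
      (fun _ => coordField C s)) t (EuclideanSpace.single C' (1 : ℝ) : Eucl k) =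
      pd C' (fun s => he.coeff α (Φ.base s)
        (Φ.map s (EuclideanSpace.single C (1 : ℝ) : Eucl k))) t := by
    intro C C'
    have h4 : (fun s => (μ (Φ.base s)).compLinearMap (Φ.map s) (fun _ => coordField C s)) =ᶠ[𝓝 t]
        fun s => he.coeff α (Φ.base s) (Φ.map s (EuclideanSpace.single C (1 : ℝ) : Eucl k)) := by
      -- Continuity of the base map pulls the neighbourhood where χ = 1 back to ℝᵏ.
      filter_upwards [hΦ.eventually h1] with s hs
      change χ (Φ.base s) * _ = _
      rw [hs, Pi.one_apply, one_mul]
      rfl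
    rw [h4.mvfderiv_eq]
    exact mvfderiv_eq_fderiv _
  have h5 := hpd A B
  have h6 := hpd B A
  have h7 : ((μ (Φ.base t)).compLinearMap (Φ.map t)) (fun _ =>
      (LieAlgebroid.tangent k (Eucl k)).bracket (coordField B) (coordField A) t) = 0 := by
    rw [bracket_coordField, AlternatingMap.compLinearMap_apply, hμ]
    have : Φ.map t ((0 : Sec k k (TangentSpace (𝓡 k) : Eucl k → Type)) t) = 0 := map_zero _
    rw [this, map_zero, mul_zero]
  have h8 : μ (Φ.base t) (fun _ => D.bracket (frameSection e (f B)) (frameSection e (f A))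
      (Φ.base t)) = ∑ β, ∑ γ, structC D he α β γ (Φ.base t) * f B β * f A γ := by
    rw [hμ, h1.self_of_nhds, Pi.one_apply, one_mul, coeff_bracket_frameSection]
  rw [← h5, ← h6]
  refine Eq.trans ?_ (h3.trans ?_)
  · exact (sub_eq_self.2 h7).symm
  · refine (congrArg₂ (· - ·) (congrArg₂ (· - ·) (hconst A _) (hconst B _)) h8).trans ?_
    simp [f]

end MaurerCartan

end EulerLagrange

/-! ### The field equations along integral sections. -/

section FieldEquationsAlongMaps

variable {n m k : ℕ} {Q : Type*} [TopologicalSpace Q] [ChartedSpace (Eucl n) Q]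
  [IsManifold (𝓡 n) ∞ Q]
  {E : Q → Type*} [∀ q, AddCommGroup (E q)] [∀ q, Module ℝ (E q)]
  [TopologicalSpace (TotalSpace (Eucl m) E)] [∀ q, TopologicalSpace (E q)]
  [FiberBundle (Eucl m) E] [VectorBundle ℝ (Eucl m) E]
  [ContMDiffVectorBundle ∞ (Eucl m) E (𝓡 n)]
  {c : OpenPartialHomeomorph Q (Eucl n)} {e : Fin m → Sec n m E} {U : Set Q}
  (he : IsLocalFrameOn (𝓡 n) (Eucl m) ∞ (fun α q => e α q) U)
  {D : LieAlgebroid n m E} {L : Phase m k E → ℝ} {ξ : ProlongationSection k D}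
  (hc : c ∈ IsManifold.maximalAtlas (𝓡 n) ∞ Q) (hU : IsOpen U) (hUc : U ⊆ c.source)
  (hL : ContMDiff (phaseModel n m k) 𝓘(ℝ, ℝ) ∞ L)

omit [IsManifold (𝓡 n) ∞ Q] in
include hc hL in
theorem dLdy_eq_fderiv {w : PhaseCoord n m k} (hw : w.2.1 ∈ c.target) (A : Fin k) (α : Fin m) :
    dLdy c e L A α w.1 w.2.1 w.2.2 =
      fderiv ℝ (coordL c e L) w (vertCoord n k A (Pi.single α 1)) := by
  have h1 : HasFDerivAt (coordL c e L) (fderiv ℝ (coordL c e L) w) w :=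
    ((contDiffAt_coordL hL hc hw).differentiableAt (by simp)).hasFDerivAt
  have h2 : HasFDerivAt (fun y => ((w.1, w.2.1, y) : PhaseCoord n m k))
      ((ContinuousLinearMap.inr ℝ _ _).comp (ContinuousLinearMap.inr ℝ _ _)) w.2.2 :=
    (hasFDerivAt_prodMk_right w.1 w.2).comp w.2.2 (hasFDerivAt_prodMk_right w.2.1 w.2.2)
  have h3 : HasFDerivAt (fun y => coordL c e L (w.1, w.2.1, y)) _ w.2.2 :=
    HasFDerivAt.comp (g := coordL c e L) w.2.2 h1 h2
  change fderiv ℝ (fun y => coordL c e L (w.1, w.2.1, y)) w.2.2 _ = _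
  rw [h3.fderiv]
  rfl

omit [IsManifold (𝓡 n) ∞ Q] in
include hc hL in
theorem dLdq_eq_fderiv {w : PhaseCoord n m k} (hw : w.2.1 ∈ c.target) (i : Fin n) :
    dLdq c e L i w.1 w.2.1 w.2.2 =
      fderiv ℝ (coordL c e L) w (0, EuclideanSpace.single i 1, 0) := by
  have h1 : HasFDerivAt (coordL c e L) (fderiv ℝ (coordL c e L) w) w :=
    ((contDiffAt_coordL hL hc hw).differentiableAt (by simp)).hasFDerivAt
  have h2 : HasFDerivAt (fun q => ((w.1, q, w.2.2) : PhaseCoord n m k))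
      ((ContinuousLinearMap.inr ℝ _ _).comp (ContinuousLinearMap.inl ℝ _ _)) w.2.1 :=
    (hasFDerivAt_prodMk_right w.1 w.2).comp w.2.1 (hasFDerivAt_prodMk_left w.2.1 w.2.2)
  have h3 : HasFDerivAt (fun q => coordL c e L (w.1, q, w.2.2)) _ w.2.1 :=
    HasFDerivAt.comp (g := coordL c e L) w.2.1 h1 h2
  change fderiv ℝ (fun q => coordL c e L (w.1, q, w.2.2)) w.2.1 _ = _
  rw [h3.fderiv]
  rfl

omit [ContMDiffVectorBundle ∞ (Eucl m) E (𝓡 n)] in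
theorem structRho_eq (hc : c ∈ IsManifold.maximalAtlas (𝓡 n) ∞ Q) {q : Q} (hq : q ∈ c.source)
    (i : Fin n) (α : Fin m) :
    structRho D c e i α q = mvfderiv (𝓡 n) c q (D.anchor q (e α q)) i := by
  have h := fderiv_comp_mvfderiv (g := EuclideanSpace.proj (𝕜 := ℝ) i)
    (EuclideanSpace.proj (𝕜 := ℝ) i).differentiableAt
    ((contMDiffAt_of_mem_maximalAtlas hc hq).mdifferentiableAt (by simp)) (D.anchor q (e α q))
  rw [ContinuousLinearMap.fderiv] at h
  exact h

variable (n k) in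
theorem vertCoord_eq_sum (A : Fin k) (u : Fin m → ℝ) :
    vertCoord n k A u = ∑ γ, u γ • vertCoord n k A (Pi.single γ (1 : ℝ)) := by
  let l : (Fin m → ℝ) →ₗ[ℝ] PhaseCoord n m k := (LinearMap.inr ℝ _ _).comp
    ((LinearMap.inr ℝ _ _).comp (LinearMap.single ℝ (fun _ : Fin k => Fin m → ℝ) A))
  have h : ∀ u, vertCoord n k A u = l u := fun u => rfl
  simp_rw [h, ← map_smul, ← map_sum]
  congr 1
  funext α
  simp [Finset.sum_apply, Pi.single_apply]

variable {ψ : Eucl k → Phase m k E} {t : Eucl k}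

omit [IsManifold (𝓡 n) ∞ Q] in
include hc hU hUc in
theorem differentiableAt_coordMap_comp (hψ : ContMDiff (𝓡 k) (phaseModel n m k) ∞ ψ)
    (ht : (ψ t).2.proj ∈ U) : DifferentiableAt ℝ (fun s => coordMap c he (ψ s)) t :=
  mdifferentiableAt_iff_differentiableAt.1
    ((mdifferentiableAt_coordMap he hc hU hUc ht).comp t (hψ.mdifferentiableAt (by simp)))

include hc hU hUc in
theorem ProlongationSection.IsIntegralSection.fderiv_coordMap (h : ξ.IsIntegralSection ψ)
    (ht : (ψ t).2.proj ∈ U) (A : Fin k) :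
    fderiv ℝ (fun s => coordMap c he (ψ s)) t (EuclideanSpace.single A 1) =
      mvfderiv (phaseModel n m k) (coordMap c he) (ψ t) ((ξ.toFun (ψ t)).2 A) :=
  (mvfderiv_eq_fderiv _).symm.trans ((mvfderiv_comp_mfderiv
    (mdifferentiableAt_coordMap he hc hU hUc ht) (h.1.mdifferentiableAt (by simp)) _).trans
    (congrArg _ (h.2 t A).symm))

include hc hU hUc in
/-- The base component of an integral section of a second order equation. -/
theorem ProlongationSection.IsIntegralSection.pd_base (h : ξ.IsIntegralSection ψ)
    (ht : (ψ t).2.proj ∈ U) (hfst : (ξ.toFun (ψ t)).1 = (ψ t).2.snd) (A : Fin k) (i : Fin n) :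
    pd A (fun s => c (ψ s).2.proj i) t =
      ∑ α, he.coeff α (ψ t).2.proj ((ψ t).2.snd A) * structRho D c e i α (ψ t).2.proj := by
  let l : PhaseCoord n m k →L[ℝ] ℝ := (EuclideanSpace.proj i).comp
    ((ContinuousLinearMap.fst ℝ _ _).comp (ContinuousLinearMap.snd ℝ _ _))
  have h1 : HasFDerivAt (fun s => l (coordMap c he (ψ s))) _ t :=
    l.hasFDerivAt.comp t (differentiableAt_coordMap_comp he hc hU hUc h.1 ht).hasFDerivAt
  change fderiv ℝ (fun s => l (coordMap c he (ψ s))) t _ = _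
  rw [h1.fderiv, ContinuousLinearMap.comp_apply, h.fderiv_coordMap he hc hU hUc ht]
  change (mvfderiv (phaseModel n m k) (coordMap c he) (ψ t) ((ξ.toFun (ψ t)).2 A)).2.1 i = _
  -- The q-part of ξ_A is ρ(a_A) by the prolongation condition, and a_A = b_A.
  rw [← mvfderiv_chart_tangentProj he hc hU hUc ht, ← ξ.mem (ψ t) A, hfst]
  conv_lhs => rw [← frameSection_coeff he ht ((ψ t).2.snd A), frameSection_apply]
  simp_rw [map_sum, map_smul, structRho_eq hc (hUc ht)]
  simp [Finset.sum_apply]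

include hc hU hUc hL in
/-- The Euler-Lagrange equations along an integral section. -/
theorem ProlongationSection.SummedFieldEquations.eulerLagrange (h : ξ.SummedFieldEquations L)
    (hψ : ξ.IsIntegralSection ψ) (ht : (ψ t).2.proj ∈ U)
    (hfst : (ξ.toFun (ψ t)).1 = (ψ t).2.snd) (α : Fin m) :
    ∑ A, pd A (fun s => dLdy c e L A α (coordMap c he (ψ s)).1 (coordMap c he (ψ s)).2.1
        (coordMap c he (ψ s)).2.2) t =
      ∑ i, structRho D c e i α (ψ t).2.proj * dLdq c e L i (coordMap c he (ψ t)).1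
          (coordMap c he (ψ t)).2.1 (coordMap c he (ψ t)).2.2 -
        ∑ A, ∑ β, ∑ γ, (coordMap c he (ψ t)).2.2 A β * structC D he γ α β (ψ t).2.proj *
          dLdy c e L A γ (coordMap c he (ψ t)).1 (coordMap c he (ψ t)).2.1
            (coordMap c he (ψ t)).2.2 := by
  set w := coordMap c he (ψ t) with hw
  have hwt : w.2.1 ∈ c.target := c.map_source (hUc ht)
  have hlhs : ∀ A, pd A (fun s => dLdy c e L A α (coordMap c he (ψ s)).1
      (coordMap c he (ψ s)).2.1 (coordMap c he (ψ s)).2.2) t =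
      fderiv ℝ (fderiv ℝ (coordL c e L)) w
        (mvfderiv (phaseModel n m k) (coordMap c he) (ψ t) ((ξ.toFun (ψ t)).2 A))
        (vertCoord n k A (Pi.single α 1)) := by
    intro A
    have h1 : (fun s => dLdy c e L A α (coordMap c he (ψ s)).1
        (coordMap c he (ψ s)).2.1 (coordMap c he (ψ s)).2.2) =ᶠ[𝓝 t]
        fun s => fderiv ℝ (coordL c e L) (coordMap c he (ψ s))
          (vertCoord n k A (Pi.single α 1)) := by
      filter_upwards [hψ.1.continuous.continuousAt.eventually (eventually_proj_mem hU ht)] with s hs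
      exact dLdy_eq_fderiv hc hL (c.map_source (hUc hs)) A α
    have h2 : HasFDerivAt (fun s => fderiv ℝ (coordL c e L) (coordMap c he (ψ s))
        (vertCoord n k A (Pi.single α 1))) _ t :=
      (HasFDerivAt.comp (g := fderiv ℝ (coordL c e L)) t
        (hasFDerivAt_fderiv_coordL he hL hc hUc ht)
        (differentiableAt_coordMap_comp he hc hU hUc hψ.1 ht).hasFDerivAt).clm_apply
        (hasFDerivAt_const _ _)
    rw [pd, h1.fderiv_eq, h2.fderiv]
    simp [hψ.fderiv_coordMap he hc hU hUc ht, hw]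
  set r := mvfderiv (𝓡 n) c (ψ t).2.proj (D.anchor (ψ t).2.proj (e α (ψ t).2.proj))
  -- The test element is e_α with tangent vector ρ(e_α) and zero t- and y-parts.
  have h3 := h.coord he hc hU hUc ht hL (Pi.single α 1) (0, r, 0) (by
    rw [frameSection_single])
  have hrho : fderiv ℝ (coordL c e L) w (0, r, 0) =
      ∑ i, structRho D c e i α (ψ t).2.proj * dLdq c e L i w.1 w.2.1 w.2.2 := by
    have h4 : ((0, r, 0) : PhaseCoord n m k) =
        ∑ i, r i • ((0, EuclideanSpace.single i 1, 0) : PhaseCoord n m k) := by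
      have h5 : ∀ i, ((0, EuclideanSpace.single i 1, 0) : PhaseCoord n m k) =
        (LinearMap.inr ℝ (Eucl k) _).comp (LinearMap.inl ℝ (Eucl n) (Fin k → Fin m → ℝ))
          (EuclideanSpace.single i (1 : ℝ)) := fun i => rfl
      simp_rw [h5, ← map_smul, ← map_sum]
      change _ = ((0, _, 0) : PhaseCoord n m k)
      congr 2
      ext i
      simp [Finset.sum_apply, Pi.single_apply]
    rw [h4, map_sum]
    refine Finset.sum_congr rfl fun i _ => ?_
    rw [map_smul, smul_eq_mul, structRho_eq hc (hUc ht), dLdq_eq_fderiv hc hL hwt]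
  -- The bracket is taken as [y_A, e_α] = y^β_A C^γ_{βα} e_γ; antisymmetry gives the minus sign.
  have hbr : ∀ A, fderiv ℝ (coordL c e L) w (vertCoord n k A fun γ =>
        he.coeff γ (ψ t).2.proj (D.bracket
          (frameSection e fun α => he.coeff α (ψ t).2.proj ((ξ.toFun (ψ t)).1 A))
          (frameSection e (Pi.single α 1)) (ψ t).2.proj)) =
      -∑ β, ∑ γ, w.2.2 A β * structC D he γ α β (ψ t).2.proj * dLdy c e L A γ w.1 w.2.1 w.2.2 := by
    intro A
    rw [vertCoord_eq_sum, map_sum, ← Finset.sum_neg_distrib]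
    simp_rw [← Finset.sum_neg_distrib]
    rw [Finset.sum_comm]
    refine Finset.sum_congr rfl fun γ _ => ?_
    rw [map_smul, smul_eq_mul, coeff_bracket_frameSection, dLdy_eq_fderiv hc hL hwt,
      Finset.sum_mul]
    refine Finset.sum_congr rfl fun β _ => ?_
    rw [structC_skew he γ α β, hfst]
    have hy : w.2.2 A β = he.coeff β (ψ t).2.proj ((ψ t).2.snd A) := rfl
    simp only [Pi.single_apply, mul_ite, mul_one, mul_zero, Finset.sum_ite_eq', Finset.mem_univ,
      if_true, hy]
    ring
  have hf : (fun A α => he.coeff α (ψ t).2.proj ((ξ.toFun (ψ t)).1 A)) = w.2.2 := by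
    rw [hfst]
    rfl
  -- Because a = y, this term equals the second-derivative term coming from the energy and cancels
  -- it.
  have hsum : ∑ A, fderiv ℝ (fderiv ℝ (coordL c e L)) w (0, r, 0)
      (vertCoord n k A fun α => he.coeff α (ψ t).2.proj ((ξ.toFun (ψ t)).1 A)) =
      fderiv ℝ (fderiv ℝ (coordL c e L)) w (0, r, 0) (0, 0, w.2.2) := by
    rw [← map_sum, ← hf]
    congr 1
    exact sum_vertCoord (n := n) _
  rw [← hw, Finset.sum_add_distrib, Finset.sum_sub_distrib, hsum] at h3
  simp_rw [hbr] at h3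
  rw [Finset.sum_neg_distrib, hrho] at h3
  simp_rw [hlhs]
  linarith

end FieldEquationsAlongMaps

end

/-- Lagrangian `k`-cosymplectic field theory on a Lie algebroid: for a regular Lagrangian, a section
`ξ` that solves the geometric field equations (or only the summed ones) is a second order partial
differential equation, and its integral sections that come from Lie algebroid morphisms `Tℝᵏ → E`
solve the Euler–Lagrange field equations. -/
theorem mainTheorem6 {n m k : ℕ} (hk : 1 ≤ k) {Q : Type*} [TopologicalSpace Q] [T2Space Q]
    [ChartedSpace (Eucl n) Q] [IsManifold (𝓡 n) ∞ Q]
    {E : Q → Type*} [∀ q, AddCommGroup (E q)] [∀ q, Module ℝ (E q)]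
    [TopologicalSpace (TotalSpace (Eucl m) E)] [∀ q, TopologicalSpace (E q)]
    [FiberBundle (Eucl m) E] [VectorBundle ℝ (Eucl m) E]
    [ContMDiffVectorBundle ∞ (Eucl m) E (𝓡 n)]
    (D : LieAlgebroid n m E) (L : Phase m k E → ℝ)
    (hL : ContMDiff (phaseModel n m k) 𝓘(ℝ, ℝ) ∞ L) (hreg : IsRegularLagrangian L)
    (ξ : ProlongationSection k D) (hξ : ξ.FieldEquations L ∨ ξ.SummedFieldEquations L) :
    ξ.IsSOPDE ∧
      ∀ Φ : LieAlgebroid.Hom (LieAlgebroid.tangent k (Eucl k)) D,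
        ξ.IsIntegralSection Φ.associatedMap → IsEulerLagrangeSolution D L Φ.associatedMap := by
  have hsum : ξ.SummedFieldEquations L := hξ.elim (fun h => h.summed hk) id
  refine ⟨hsum.isSOPDE hL hreg, fun Φ hΦ => ⟨hΦ.1, fun c hc U hU hUc e he t ht => ?_⟩⟩
  have hfst := hsum.fst_eq he hc hU hUc ht hL hreg
  refine ⟨fun A B => ?_, fun A i => hΦ.pd_base he hc hU hUc ht hfst A i, fun A B α => ?_,
    hsum.eulerLagrange he hc hU hUc hL hΦ ht hfst⟩
  -- The first component of Φ̃ is the identity of ℝᵏ, so φ^B is a coordinate projection.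
  · change fderiv ℝ (EuclideanSpace.proj (𝕜 := ℝ) B) t (EuclideanSpace.single A (1 : ℝ)) = _
    rw [ContinuousLinearMap.fderiv]
    simp [eq_comm]
  · have hcont : ContinuousAt Φ.base t :=
      (((FiberBundle.continuous_proj (Fin k → Eucl m) (WhitneySum k E)).comp
        continuous_snd).comp hΦ.1.continuous).continuousAt
    have h := Φ.maurerCartan he hU ht hcont A B α
    exact (eq_neg_iff_add_eq_zero.1 h).symm
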